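/- Let $X_1,X_2,\dots$ be i.i.d. real random variables with $\mathbb P(X_1>0)>0$, let $S_n=\sum_{i=1}^n X_i$, and for $y\in\mathbb R$ let $Y_n=y+S_n$, $n\ge 0$, be the random walk started in $y$ (with $\mathbb E_y$ the corresponding expectation). Let $\gamma:\mathbb R\to\mathbb R$ be non-decreasing and let $h:\mathbb R\to[0,\infty)$ be non-negative and non-decreasing. Consider the optimal stopping problem $$V(y)=\sup_{\tau}\ \mathbb E_y\Big(\gamma(Y_\tau)-\sum_{i=1}^{\tau}h(Y_i)\Big),$$ the supremum being over all stopping times of the natural filtration of $Y$ (the reward of never stopping being $-\infty$). Assume that for all $y\in\mathbb R$ $$\mathbb E_y\Big(\sup_{n\ge 0}\Big(\gamma(Y_n)-\sum_{i=1}^n h(Y_i)\Big)\Big)<\infty\qquad\text{and}\qquad \gamma(Y_n)-\sum_{i=1}^n h(Y_i)\to-\infty\quad \mathbb P_y\text{-a.s.}$$ Let $\tau^+=\inf\{n\ge 0: S_n>0\}$ be the first strict ascending ladder time and put $$f(y)=\frac{\mathbb E\big(\gamma(y+S_{\tau^+})-\sum_{i=1}^{\tau^+}h(y+S_i)\big)-\gamma(y)}{\mathbb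 E(\tau^+)},\qquad y\in\mathbb R,$$ where it is assumed that all terms in this definition are finite, i.e. $\mathbb E(\tau^+)<\infty$, and $\gamma(y+S_{\tau^+})$ and $\sum_{i=1}^{\tau^+}h(y+S_i)$ are integrable for every $y$. Let $$\bar x=\inf\Big\{y\in\mathbb R\ :\ \mathbb E\big(\gamma(y)-\gamma(y+S_{\tau^+})\big)\ \ge\ -\,\mathbb E\Big(\sum_{i=1}^{\tau^+}h(y+S_i)\Big)\Big\},$$ assume that $\bar x\in\mathbb R$ (that is, the set is non-empty and bounded below), and assume that $\gamma$ is concave on $[\bar x,\infty)$. Then: * if $f(\bar x)\le 0$, then $\tau^*=\inf\{n\ge 0: Y_n\ge\bar x\}$ is an optimal stopping time for $V(y)$, for every $y\in\mathbb R$; * if $f(\bar x)>0$, then $\tau^*=\inf\{n\ge 0: Y_n>\bar x\}$ is an optimal stopping time for $V(y)$, for every $y\in\mathbb R$. -/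

import Mathlib

open MeasureTheory ProbabilityTheory Filter Topology Set
open scoped ENNReal

namespace RWStopping

variable {Ω : Type*}

/-- The partial sums `S n = X₁ + ⋯ + Xₙ`; the sequence is indexed from `0`, so that `X i` stands
for the `(i+1)`-st increment. -/
def walk (X : ℕ → Ω → ℝ) (n : ℕ) (ω : Ω) : ℝ := ∑ i ∈ Finset.range n, X i ω

/-- The random walk `Y n = y + S n` started in `y`. -/
def startedWalk (X : ℕ → Ω → ℝ) (y : ℝ) (n : ℕ) (ω : Ω) : ℝ := y + walk X n ω

/-- The accumulated running cost `∑_{i=1}^n h (Y i)`. -/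
def runningCost (X : ℕ → Ω → ℝ) (h : ℝ → ℝ) (y : ℝ) (n : ℕ) (ω : Ω) : ℝ :=
  ∑ i ∈ Finset.Icc 1 n, h (startedWalk X y i ω)

/-- The net reward `γ (Y n) - ∑_{i=1}^n h (Y i)` of stopping at time `n`. -/
def reward (X : ℕ → Ω → ℝ) (γ h : ℝ → ℝ) (y : ℝ) (n : ℕ) (ω : Ω) : ℝ :=
  γ (startedWalk X y n ω) - runningCost X h y n ω

/-- The net reward of stopping at a possibly infinite time. Never stopping yields `-∞`, the almost
sure limit of the rewards in the problems considered. -/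
noncomputable def rewardAt (X : ℕ → Ω → ℝ) (γ h : ℝ → ℝ) (y : ℝ) : WithTop ℕ → Ω → EReal
  | none, _ => ⊥
  | some n, ω => (reward X γ h y n ω : EReal)

/-- The strict ascending ladder time `τ⁺ = inf {n ≥ 0 | S n > 0} = inf {n ≥ 0 | Y n > Y 0}`. -/
noncomputable def ladderTime (X : ℕ → Ω → ℝ) : Ω → WithTop ℕ :=
  hittingAfter (walk X) (Ioi 0) 0

variable [MeasurableSpace Ω]

/-- The expectation `E Z = E Z⁺ - E Z⁻` of an extended real random variable. (It is the usual one
whenever `E Z⁺` or `E Z⁻` is finite.) -/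
noncomputable def expect (P : Measure Ω) (Z : Ω → EReal) : EReal :=
  ((∫⁻ ω, (Z ω).toENNReal ∂P : ℝ≥0∞) : EReal) - ((∫⁻ ω, (-Z ω).toENNReal ∂P : ℝ≥0∞) : EReal)

/-- `E τ⁺ ∈ [0, ∞]`. -/
noncomputable def meanLadderTime (P : Measure Ω) (X : ℕ → Ω → ℝ) : ℝ≥0∞ :=
  ∫⁻ ω, ENat.toENNReal (ladderTime X ω) ∂P

/-- `φ y = E (γ (y + S_{τ⁺}) - ∑_{i=1}^{τ⁺} h (y + S i))`. -/
noncomputable def ladderReward (P : Measure Ω) (X : ℕ → Ω → ℝ) (γ h : ℝ → ℝ) (y : ℝ) : ℝ :=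
  ∫ ω, stoppedValue (reward X γ h y) (ladderTime X) ω ∂P

/-- `f y = (φ y - γ y) / E τ⁺`. -/
noncomputable def gainRate (P : Measure Ω) (X : ℕ → Ω → ℝ) (γ h : ℝ → ℝ) (y : ℝ) : ℝ :=
  (ladderReward P X γ h y - γ y) / (meanLadderTime P X).toReal

/-- All quantities that enter `f` are finite: `E τ⁺ < ∞` and, for every `y`, both
`γ (y + S_{τ⁺})` and `∑_{i=1}^{τ⁺} h (y + S i)` are integrable. -/
structure GainRateWellDefined (P : Measure Ω) (X : ℕ → Ω → ℝ) (γ h : ℝ → ℝ) : Prop where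
  meanLadderTime_lt_top : meanLadderTime P X < ⊤
  integrable_payoff : ∀ y, Integrable
    (fun ω => γ (stoppedValue (startedWalk X y) (ladderTime X) ω)) P
  integrable_cost : ∀ y, Integrable (stoppedValue (runningCost X h y) (ladderTime X)) P

/-- The levels `y` with `E (γ y - γ (y + S_{τ⁺})) ≥ - E (∑_{i=1}^{τ⁺} h (y + S i))`, at which the
expected net gain from waiting for the next ladder height is non-positive. -/
def noGainSet (P : Measure Ω) (X : ℕ → Ω → ℝ) (γ h : ℝ → ℝ) : Set ℝ :=
  {y | ∫ ω, (γ y - γ (stoppedValue (startedWalk X y) (ladderTime X) ω)) ∂P ≥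
    -∫ ω, stoppedValue (runningCost X h y) (ladderTime X) ω ∂P}

/-- For every starting point `y`, `E_y (sup_n (γ (Y n) - ∑_{i=1}^n h (Y i))) < ∞`, and
`γ (Y n) - ∑_{i=1}^n h (Y i) → -∞` almost surely. -/
structure StandingAssumption (P : Measure Ω) (X : ℕ → Ω → ℝ) (γ h : ℝ → ℝ) : Prop where
  expect_sup_lt_top : ∀ y, expect P (fun ω => ⨆ n : ℕ, (reward X γ h y n ω : EReal)) < ⊤
  tendsto_atBot : ∀ y, ∀ᵐ ω ∂P, Tendsto (fun n => reward X γ h y n ω) atTop atBot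

theorem stronglyMeasurable_startedWalk {X : ℕ → Ω → ℝ} (hX : ∀ i, Measurable (X i)) (y : ℝ)
    (n : ℕ) : StronglyMeasurable (startedWalk X y n) :=
  (measurable_const.add
    (Finset.measurable_fun_sum (Finset.range n) fun i _ => hX i)).stronglyMeasurable

/-- The natural filtration `σ(Y 0, …, Y n)` of the walk started in `y`. -/
noncomputable def walkFiltration {X : ℕ → Ω → ℝ} (hX : ∀ i, Measurable (X i)) (y : ℝ) :
    Filtration ℕ (inferInstance : MeasurableSpace Ω) :=
  Filtration.natural (startedWalk X y) (stronglyMeasurable_startedWalk hX y)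

/-- The value function `V y = sup_τ E_y (γ (Y τ) - ∑_{i=1}^τ h (Y i))`, the supremum being over
all stopping times of the walk. -/
noncomputable def value {X : ℕ → Ω → ℝ} (hX : ∀ i, Measurable (X i)) (P : Measure Ω)
    (γ h : ℝ → ℝ) (y : ℝ) : EReal :=
  ⨆ (τ : Ω → WithTop ℕ) (_ : IsStoppingTime (walkFiltration hX y) τ),
    expect P (fun ω => rewardAt X γ h y (τ ω) ω)

/-- `τ` is an optimal stopping time for the walk started in `y`. -/
def IsOptimal {X : ℕ → Ω → ℝ} (hX : ∀ i, Measurable (X i)) (P : Measure Ω)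
    (γ h : ℝ → ℝ) (y : ℝ) (τ : Ω → WithTop ℕ) : Prop :=
  IsStoppingTime (walkFiltration hX y) τ ∧
    expect P (fun ω => rewardAt X γ h y (τ ω) ω) = value hX P γ h y

end RWStopping

namespace RWStopping

/-! Write φ(z) for the expected reward at the first ladder time and e for the mean ladder time, and
let A be the stopping set, `Ici xbar` or `Ioi xbar`. Below `xbar` waiting for the next ladder height
pays, φ ≥ γ, by the definition of the infimum. As γ is concave and h monotone, φ - γ is
non-increasing on [xbar, ∞), so φ ≤ γ above `xbar`; the sign of f(xbar) decides about the boundary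
point. Thus φ ≥ γ off A and φ ≤ γ on A.

Off A, chaining ladder times by the strong Markov property shows that waiting for A is favourable
(`le_integral_reward_hit`). The chaining rests on the growth bound `le_of_le_add_lintegral_ladder`,
which also gives almost sure entrance into A and integrability of the cost until then.

On A, comparing with the ladder time is not enough, since the walk may return to A below its
starting point y. A bonus c = -f(y) ≥ 0 per unit of time makes the ladder time neutral at y and, by
concavity, favourable at every lower level. With the bonus, going on from the return to A until y is
exceeded is favourable, while the whole excursion up to the ladder time is worth γ(y). So returning
to A is worth at most γ(y) (`integral_reward_return_le`).

An arbitrary stopping time τ is handled in `integral_reward_le`. Postponing it to the next visit to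
A costs nothing; let R' be the resulting reward and R n the reward at the first visit to A from n
on. Then E(R' - R n; τ ≥ n) is non-decreasing in n by the return inequality. It is at most a
constant times P(τ ≥ n), because concavity bounds every later gain by the supremal gain from `xbar`.
Letting n → ∞ gives E R' ≤ E R 0, the value of entering A. -/

/-- Partial sums of a real sequence. -/
def psum (x : ℕ → ℝ) (n : ℕ) : ℝ := ∑ i ∈ Finset.range n, x i

/-- The sequence with its first `n` entries removed. -/
def shift (n : ℕ) (x : ℕ → ℝ) : ℕ → ℝ := fun i => x (n + i)

/-- The running cost along the path started in `z` with increments `x`. -/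
def pathCost (h : ℝ → ℝ) (z : ℝ) (n : ℕ) (x : ℕ → ℝ) : ℝ :=
  ∑ i ∈ Finset.Icc 1 n, h (z + psum x i)

/-- The net reward along the path started in `z` with increments `x`. -/
def pathReward (γ h : ℝ → ℝ) (z : ℝ) (n : ℕ) (x : ℕ → ℝ) : ℝ :=
  γ (z + psum x n) - pathCost h z n x

/-- The first time from `n` on at which the path started in `z` is in `A` (and `0` if there is
none). -/
noncomputable def hit (A : Set ℝ) (n : ℕ) (z : ℝ) (x : ℕ → ℝ) : ℕ :=
  sInf {m | n ≤ m ∧ z + psum x m ∈ A}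

/-- The strict ascending ladder time of a sequence of increments. -/
noncomputable def ladder (x : ℕ → ℝ) : ℕ := hit (Ioi 0) 0 0 x

/-- The path started in `z` visits `A` at some time from `n` on. -/
def Hits (A : Set ℝ) (n : ℕ) (z : ℝ) (x : ℕ → ℝ) : Prop := ∃ m, n ≤ m ∧ z + psum x m ∈ A

/-! ### Path decompositions at hitting times -/

section Path

variable {A : Set ℝ} {n k : ℕ} {z : ℝ} {x : ℕ → ℝ} {γ h : ℝ → ℝ}

@[simp] lemma psum_zero (x : ℕ → ℝ) : psum x 0 = 0 := by simp [psum]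

lemma psum_add (x : ℕ → ℝ) (n m : ℕ) : psum x (n + m) = psum x n + psum (shift n x) m := by
  simp [psum, shift, Finset.sum_range_add]

lemma psum_one (x : ℕ → ℝ) : psum x 1 = x 0 := by simp [psum]

@[simp] lemma pathCost_zero (h : ℝ → ℝ) (z : ℝ) (x : ℕ → ℝ) : pathCost h z 0 x = 0 := by
  simp [pathCost]

@[simp] lemma pathReward_zero (γ h : ℝ → ℝ) (z : ℝ) (x : ℕ → ℝ) :
    pathReward γ h z 0 x = γ z := by
  simp [pathReward]

lemma pathCost_succ (h : ℝ → ℝ) (z : ℝ) (n : ℕ) (x : ℕ → ℝ) :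
    pathCost h z (n + 1) x = pathCost h z n x + h (z + psum x (n + 1)) := by
  simp [pathCost, Finset.sum_Icc_succ_top]

lemma pathCost_add (h : ℝ → ℝ) (z : ℝ) (n m : ℕ) (x : ℕ → ℝ) :
    pathCost h z (n + m) x = pathCost h z n x + pathCost h (z + psum x n) m (shift n x) := by
  induction m with
  | zero => simp
  | succ m ih =>
    rw [← add_assoc, pathCost_succ, ih, pathCost_succ, add_assoc n m 1, psum_add]
    ring_nf

lemma pathReward_add (γ h : ℝ → ℝ) (z : ℝ) (n m : ℕ) (x : ℕ → ℝ) :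
    pathReward γ h z (n + m) x = pathReward γ h z n x +
      (pathReward γ h (z + psum x n) m (shift n x) - γ (z + psum x n)) := by
  simp only [pathReward, pathCost_add, psum_add, add_assoc]
  ring

lemma pathCost_nonneg (hh0 : ∀ x, 0 ≤ h x) (z : ℝ) (n : ℕ) (x : ℕ → ℝ) :
    0 ≤ pathCost h z n x := Finset.sum_nonneg fun _ _ => hh0 _

lemma pathCost_mono_time (hh0 : ∀ x, 0 ≤ h x) (z : ℝ) {m n : ℕ} (hmn : m ≤ n) (x : ℕ → ℝ) :
    pathCost h z m x ≤ pathCost h z n x :=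
  Finset.sum_le_sum_of_subset_of_nonneg (Finset.Icc_subset_Icc_right hmn) fun _ _ _ => hh0 _

lemma pathCost_mono_start (hh : Monotone h) {z z' : ℝ} (hz : z ≤ z') (n : ℕ) (x : ℕ → ℝ) :
    pathCost h z n x ≤ pathCost h z' n x :=
  Finset.sum_le_sum fun _ _ => hh (by linarith)

lemma Hits.le (hx : Hits A n z x) : n ≤ hit A n z x := (Nat.sInf_mem hx).1

lemma Hits.mem (hx : Hits A n z x) : z + psum x (hit A n z x) ∈ A := (Nat.sInf_mem hx).2

lemma notMem_of_lt_hit (hnk : n ≤ k) (hk : k < hit A n z x) : z + psum x k ∉ A :=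
  fun hA => Nat.notMem_of_lt_sInf hk ⟨hnk, hA⟩

lemma hit_le (hnk : n ≤ k) (hk : z + psum x k ∈ A) : hit A n z x ≤ k := Nat.sInf_le ⟨hnk, hk⟩

lemma hit_eq (hnk : n ≤ k) (hk : z + psum x k ∈ A)
    (hlt : ∀ j, n ≤ j → j < k → z + psum x j ∉ A) : hit A n z x = k := by
  refine le_antisymm (hit_le hnk hk) ?_
  by_contra! hcon
  have hx : Hits A n z x := ⟨k, hnk, hk⟩
  exact hlt _ hx.le hcon hx.mem

lemma hit_zero_of_mem (hz : z ∈ A) : hit A 0 z x = 0 :=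
  hit_eq le_rfl (by simpa using hz) (by simp)

lemma Hits.shift (hx : Hits A n z x) (hlt : ∀ j, n ≤ j → j < k → z + psum x j ∉ A) :
    Hits A 0 (z + psum x k) (shift k x) := by
  obtain ⟨m, hm, hmA⟩ := hx
  have hkm : k ≤ m := by
    by_contra! hcon
    exact hlt m hm hcon hmA
  refine ⟨m - k, Nat.zero_le _, ?_⟩
  rwa [add_assoc, ← psum_add, Nat.add_sub_cancel' hkm]

lemma hit_eq_add (hx : Hits A n z x) (hnk : n ≤ k)
    (hlt : ∀ j, n ≤ j → j < k → z + psum x j ∉ A) :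
    hit A n z x = k + hit A 0 (z + psum x k) (RWStopping.shift k x) := by
  have hx' := hx.shift hlt
  refine hit_eq (by omega) ?_ fun j hj hjk => ?_
  · rw [psum_add, ← add_assoc]
    exact hx'.mem
  · rcases lt_or_ge j k with hjk' | hkj
    · exact hlt j hj hjk'
    · have := notMem_of_lt_hit (A := A) (z := z + psum x k) (x := RWStopping.shift k x)
        (n := 0) (k := j - k) (Nat.zero_le _) (by omega)
      rwa [add_assoc, ← psum_add, Nat.add_sub_cancel' hkj] at this

lemma Hits.of_shift (hx : Hits A 0 (z + psum x k) (RWStopping.shift k x)) (hnk : n ≤ k) :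
    Hits A n z x := by
  obtain ⟨m, -, hm⟩ := hx
  refine ⟨k + m, by omega, ?_⟩
  rwa [psum_add, ← add_assoc]

lemma hit_succ_of_notMem (hz : z ∉ A) (hx : Hits A 0 z x) : hit A 1 z x = hit A 0 z x := by
  have h1 : 1 ≤ hit A 0 z x := by
    by_contra! hcon
    have := hx.mem
    rw [Nat.lt_one_iff.1 hcon] at this
    simp_all
  exact hit_eq h1 hx.mem fun j _ hj => notMem_of_lt_hit (Nat.zero_le _) hj

lemma ladder_spec (hx : Hits (Ioi 0) 0 0 x) :
    0 < psum x (ladder x) ∧ ∀ j < ladder x, psum x j ≤ 0 := by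
  refine ⟨by simpa [ladder] using hx.mem, fun j hj => ?_⟩
  simpa using notMem_of_lt_hit (Nat.zero_le _) hj

lemma ladder_pos (hx : Hits (Ioi 0) 0 0 x) : 1 ≤ ladder x := by
  by_contra! hcon
  have := (ladder_spec hx).1
  rw [Nat.lt_one_iff.1 hcon] at this
  simp at this

lemma ladder_eq_hit (z : ℝ) (x : ℕ → ℝ) : ladder x = hit (Ioi z) 0 z x := by
  simp [ladder, hit]

lemma notMem_of_lt_ladder (hA : IsUpperSet A) (hz : z ∉ A) (hx : Hits (Ioi 0) 0 0 x) {j : ℕ}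
    (hj : j < ladder x) : z + psum x j ∉ A := fun hj' =>
  hz (hA (by linarith [(ladder_spec hx).2 j hj]) hj')

lemma ladder_eq_one (hx : 0 < x 0) : ladder x = 1 :=
  hit_eq (Nat.zero_le _) (by simpa [psum_one] using hx) fun j _ hj => by
    simp [Nat.lt_one_iff.1 hj]

end Path

/-! ### Joint measurability in the starting point and the path -/

section Measurability

variable {A : Set ℝ} {γ h : ℝ → ℝ}

@[fun_prop] lemma measurable_psum (n : ℕ) : Measurable fun x : ℕ → ℝ => psum x n := by
  unfold psum; fun_prop

@[fun_prop] lemma measurable_shift (n : ℕ) : Measurable (shift n) := by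
  unfold shift; fun_prop

lemma measurable_pathCost (hh : Measurable h) (n : ℕ) :
    Measurable fun p : ℝ × (ℕ → ℝ) => pathCost h p.1 n p.2 := by
  unfold pathCost; fun_prop

lemma measurable_pathReward (hγ : Measurable γ) (hh : Measurable h) (n : ℕ) :
    Measurable fun p : ℝ × (ℕ → ℝ) => pathReward γ h p.1 n p.2 := by
  unfold pathReward
  exact (hγ.comp (by fun_prop)).sub (measurable_pathCost hh n)

lemma measurableSet_visit (hA : MeasurableSet A) (m : ℕ) :
    MeasurableSet {p : ℝ × (ℕ → ℝ) | p.1 + psum p.2 m ∈ A} :=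
  (show Measurable fun p : ℝ × (ℕ → ℝ) => p.1 + psum p.2 m by fun_prop) hA

lemma measurableSet_hits (hA : MeasurableSet A) (n : ℕ) :
    MeasurableSet {p : ℝ × (ℕ → ℝ) | Hits A n p.1 p.2} := by
  have : {p : ℝ × (ℕ → ℝ) | Hits A n p.1 p.2} =
      ⋃ m, ⋃ (_ : n ≤ m), {p : ℝ × (ℕ → ℝ) | p.1 + psum p.2 m ∈ A} := by
    ext p; simp [Hits]
  rw [this]
  exact .iUnion fun m => .iUnion fun _ => measurableSet_visit hA m

lemma measurable_hit (hA : MeasurableSet A) (n : ℕ) :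
    Measurable fun p : ℝ × (ℕ → ℝ) => hit A n p.1 p.2 := by
  refine measurable_of_Iic fun k => ?_
  -- Paths that never visit `A` have the default value `0` and so lie in every such preimage.
  have : (fun p : ℝ × (ℕ → ℝ) => hit A n p.1 p.2) ⁻¹' Iic k =
      (⋃ m, ⋃ (_ : n ≤ m ∧ m ≤ k), {p : ℝ × (ℕ → ℝ) | p.1 + psum p.2 m ∈ A}) ∪
        {p : ℝ × (ℕ → ℝ) | Hits A n p.1 p.2}ᶜ := by
    ext p
    simp only [mem_preimage, mem_Iic, mem_union, mem_iUnion, mem_ofPred_eq, mem_compl_iff,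
      exists_prop]
    constructor
    · intro hp
      by_cases hx : Hits A n p.1 p.2
      · exact Or.inl ⟨_, ⟨hx.le, hp⟩, hx.mem⟩
      · exact Or.inr hx
    · rintro (⟨m, ⟨h1, h2⟩, h3⟩ | hx)
      · exact (hit_le h1 h3).trans h2
      · have : hit A n p.1 p.2 = 0 := by
          rw [hit, Nat.sInf_eq_zero]
          exact Or.inr (Set.eq_empty_of_forall_notMem fun m hm => hx ⟨m, hm⟩)
        omega
  rw [this]
  exact (MeasurableSet.iUnion fun m => .iUnion fun _ => measurableSet_visit hA m).union
    (measurableSet_hits hA n).compl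

lemma measurable_pathCost_at (hh : Measurable h) {T : ℝ × (ℕ → ℝ) → ℕ} (hT : Measurable T) :
    Measurable fun p : ℝ × (ℕ → ℝ) => pathCost h p.1 (T p) p.2 :=
  (measurable_from_prod_countable_left (f := fun q : (ℝ × (ℕ → ℝ)) × ℕ =>
    pathCost h q.1.1 q.2 q.1.2) fun n => measurable_pathCost hh n).comp (measurable_id.prodMk hT)

lemma measurable_psum_at {α : Type*} [MeasurableSpace α] {f : α → ℕ → ℝ} {T : α → ℕ}
    (hf : Measurable f) (hT : Measurable T) : Measurable fun a => psum (f a) (T a) :=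
  (measurable_from_prod_countable_left (f := fun q : (ℕ → ℝ) × ℕ =>
    psum q.1 q.2) fun n => measurable_psum n).comp (hf.prodMk hT)

lemma measurable_shift_at {α : Type*} [MeasurableSpace α] {f : α → ℕ → ℝ} {T : α → ℕ}
    (hf : Measurable f) (hT : Measurable T) : Measurable fun a => shift (T a) (f a) :=
  (measurable_from_prod_countable_left (f := fun q : (ℕ → ℝ) × ℕ =>
    shift q.2 q.1) fun n => measurable_shift n).comp (hf.prodMk hT)

lemma measurable_pathReward_at (hγ : Measurable γ) (hh : Measurable h) {T : ℝ × (ℕ → ℝ) → ℕ}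
    (hT : Measurable T) : Measurable fun p : ℝ × (ℕ → ℝ) => pathReward γ h p.1 (T p) p.2 :=
  (measurable_from_prod_countable_left (f := fun q : (ℝ × (ℕ → ℝ)) × ℕ =>
    pathReward γ h q.1.1 q.2 q.1.2) fun n => measurable_pathReward hγ hh n).comp
    (measurable_id.prodMk hT)

lemma measurable_ladder : Measurable ladder :=
  (measurable_hit measurableSet_Ioi 0).comp (measurable_const.prodMk measurable_id)

end Measurability

/-! ### The strong Markov property -/

section StrongMarkov

variable {Ω : Type*} {X : ℕ → Ω → ℝ}

/-- The sequence of increments at an outcome. -/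
def seq (X : ℕ → Ω → ℝ) (ω : Ω) : ℕ → ℝ := fun i => X i ω

/-- The information carried by the first `n` increments. -/
@[reducible]
def past (X : ℕ → Ω → ℝ) (n : ℕ) : MeasurableSpace Ω :=
  ⨆ i ∈ Iio n, MeasurableSpace.comap (X i) inferInstance

lemma past_mono {m n : ℕ} (hmn : m ≤ n) : past X m ≤ past X n :=
  biSup_mono fun _ hi => lt_of_lt_of_le hi hmn

lemma measurable_past_psum {m n : ℕ} (hmn : m ≤ n) :
    Measurable[past X n] fun ω => psum (seq X ω) m := by
  unfold psum seq
  refine Finset.measurable_fun_sum _ fun i hi => ?_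
  have hi' : i ∈ Iio n := lt_of_lt_of_le (Finset.mem_range.1 hi) hmn
  exact (comap_measurable (X i)).mono (le_biSup (fun i => MeasurableSpace.comap (X i) _) hi') le_rfl

variable [MeasurableSpace Ω] {P : Measure Ω}

lemma past_le (hX : ∀ i, Measurable (X i)) (n : ℕ) : past X n ≤ ‹MeasurableSpace Ω› :=
  iSup₂_le fun i _ => (hX i).comap_le

lemma measurable_seq (hX : ∀ i, Measurable (X i)) : Measurable (seq X) :=
  measurable_pi_lambda _ hX

lemma map_shift_seq [IsProbabilityMeasure P] (hX : ∀ i, Measurable (X i))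
    (hindep : iIndepFun X P) (hident : ∀ i, IdentDistrib (X i) (X 0) P P) (n : ℕ) :
    P.map (fun ω => shift n (seq X ω)) = P.map (seq X) := by
  have h1 := hindep.map_fun_eq_infinitePi_map hX
  have h2 := (hindep.precomp (add_right_injective n)).map_fun_eq_infinitePi_map
    (fun i => hX (n + i))
  change P.map (fun ω i => X (n + i) ω) = P.map (fun ω i => X i ω)
  rw [h1]
  refine h2.trans ?_
  congr 1
  ext1 i
  exact ((hident (n + i)).trans (hident i).symm).map_eq

lemma measure_inter_shift [IsProbabilityMeasure P] (hX : ∀ i, Measurable (X i))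
    (hindep : iIndepFun X P) (hident : ∀ i, IdentDistrib (X i) (X 0) P P) {n : ℕ} {B : Set Ω}
    (hB : MeasurableSet[past X n] B) {t : Set (ℕ → ℝ)} (ht : MeasurableSet t) :
    P (B ∩ (fun ω => shift n (seq X ω)) ⁻¹' t) = P B * P.map (seq X) t := by
  have hind : Indep (past X n) (⨆ i ∈ Ici n, MeasurableSpace.comap (X i) inferInstance) P :=
    indep_iSup_of_disjoint (fun i => (hX i).comap_le) hindep
      (Set.disjoint_left.2 fun i hi hi' => not_lt.2 (mem_Ici.1 hi') (mem_Iio.1 hi))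
  have hmeas : Measurable[⨆ i ∈ Ici n, MeasurableSpace.comap (X i) inferInstance]
      fun ω => shift n (seq X ω) := by
    refine @measurable_pi_lambda _ _ _ (_) _ _ fun i => ?_
    have hi' : n + i ∈ Ici n := Nat.le_add_right n i
    exact (comap_measurable (X (n + i))).mono
      (le_biSup (fun i => MeasurableSpace.comap (X i) _) hi') le_rfl
  have hs : Measurable fun ω => shift n (seq X ω) := (measurable_shift n).comp (measurable_seq hX)
  rw [(Indep_iff _ _ _).1 hind B _ hB (hmeas ht), ← map_shift_seq hX hindep hident n,
    Measure.map_apply hs ht]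

lemma map_restrict_past [IsProbabilityMeasure P] (hX : ∀ i, Measurable (X i))
    (hindep : iIndepFun X P) (hident : ∀ i, IdentDistrib (X i) (X 0) P P) {n : ℕ} {B : Set Ω}
    (hB : MeasurableSet[past X n] B) {U : Ω → ℝ} (hU : Measurable[past X n] U) :
    (P.restrict B).map (fun ω => (U ω, shift n (seq X ω))) =
      ((P.restrict B).map U).prod (P.map (seq X)) := by
  have hle := past_le hX n
  have hU' : Measurable U := hU.mono hle le_rfl
  have hs : Measurable fun ω => shift n (seq X ω) := (measurable_shift n).comp (measurable_seq hX)
  have := Measure.isProbabilityMeasure_map (μ := P) (measurable_seq hX).aemeasurable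
  symm
  refine Measure.prod_eq fun s t hms hmt => ?_
  rw [Measure.map_apply (hU'.prodMk hs) (hms.prod hmt), Measure.map_apply hU' hms,
    Measure.restrict_apply ((hU'.prodMk hs) (hms.prod hmt)), Measure.restrict_apply (hU' hms),
    ← measure_inter_shift hX hindep hident (@MeasurableSet.inter _ (past X n) _ _ (hU hms) hB) hmt]
  congr 1
  ext ω
  simp only [mem_inter_iff, mem_preimage, mem_prod]
  tauto

/-- The strong Markov property: on an event `E` that is compatible with the random time `T`, the
increments after `T` are independent of the position at `T` and distributed as the whole
sequence. -/
theorem map_restrict_eq_prod [IsProbabilityMeasure P] (hX : ∀ i, Measurable (X i))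
    (hindep : iIndepFun X P) (hident : ∀ i, IdentDistrib (X i) (X 0) P P) (y : ℝ) {E : Set Ω}
    {T : Ω → ℕ} (hE : ∀ n, MeasurableSet[past X n] (E ∩ {ω | T ω = n})) :
    AEMeasurable (fun ω => (y + psum (seq X ω) (T ω), shift (T ω) (seq X ω))) (P.restrict E) ∧
    (P.restrict E).map (fun ω => (y + psum (seq X ω) (T ω), shift (T ω) (seq X ω))) =
      ((P.restrict E).map fun ω => y + psum (seq X ω) (T ω)).prod (P.map (seq X)) := by
  have hm : ∀ n, MeasurableSet (E ∩ {ω | T ω = n}) := fun n => past_le hX n _ (hE n)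
  -- Splitting `E` according to the value of `T` reduces the claim to deterministic times.
  have hres : P.restrict E = Measure.sum fun n => P.restrict (E ∩ {ω | T ω = n}) := by
    rw [← Measure.restrict_iUnion _ hm, ← Set.inter_iUnion]
    · congr 1
      ext ω
      simp
    · intro m n hmn
      refine Set.disjoint_left.2 ?_
      rintro ω ⟨-, h1⟩ ⟨-, h2⟩
      exact hmn (h1.symm.trans h2)
  have hU : ∀ n, Measurable[past X n] fun ω => y + psum (seq X ω) n := fun n =>
    (@measurable_const _ _ _ (past X n) y).add (measurable_past_psum le_rfl)
  have hU' : ∀ n, Measurable fun ω => y + psum (seq X ω) n := fun n =>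
    (hU n).mono (past_le hX n) le_rfl
  have hs : ∀ n, Measurable fun ω => shift n (seq X ω) := fun n =>
    (measurable_shift n).comp (measurable_seq hX)
  have hcongr : ∀ n, (fun ω => (y + psum (seq X ω) n, shift n (seq X ω)))
      =ᵐ[P.restrict (E ∩ {ω | T ω = n})]
      (fun ω => (y + psum (seq X ω) (T ω), shift (T ω) (seq X ω))) := fun n => by
    filter_upwards [ae_restrict_mem (hm n)] with ω hω
    rw [show T ω = n from hω.2]
  have hcongr' : ∀ n, (fun ω => y + psum (seq X ω) n)
      =ᵐ[P.restrict (E ∩ {ω | T ω = n})] (fun ω => y + psum (seq X ω) (T ω)) := fun n => by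
    filter_upwards [hcongr n] with ω hω using congrArg Prod.fst hω
  have hae : AEMeasurable (fun ω => (y + psum (seq X ω) (T ω), shift (T ω) (seq X ω)))
      (P.restrict E) := by
    rw [hres, aemeasurable_sum_measure_iff]
    exact fun n => ((hU' n).prodMk (hs n)).aemeasurable.congr (hcongr n)
  refine ⟨hae, ?_⟩
  have hae' : AEMeasurable (fun ω => y + psum (seq X ω) (T ω)) (P.restrict E) := hae.fst
  have := Measure.isProbabilityMeasure_map (μ := P) (measurable_seq hX).aemeasurable
  rw [hres] at hae hae' ⊢
  rw [Measure.map_sum hae, Measure.map_sum hae', Measure.prod_sum_left]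
  congr 1
  ext1 n
  rw [← Measure.map_congr (hcongr n), ← Measure.map_congr (hcongr' n)]
  exact map_restrict_past hX hindep hident (hE n) (hU n)

theorem lintegral_after [IsProbabilityMeasure P] (hX : ∀ i, Measurable (X i))
    (hindep : iIndepFun X P) (hident : ∀ i, IdentDistrib (X i) (X 0) P P) (y : ℝ) {E : Set Ω}
    {T : Ω → ℕ} (hE : ∀ n, MeasurableSet[past X n] (E ∩ {ω | T ω = n}))
    {Φ : ℝ × (ℕ → ℝ) → ℝ≥0∞} (hΦ : Measurable Φ) :
    ∫⁻ ω in E, Φ (y + psum (seq X ω) (T ω), shift (T ω) (seq X ω)) ∂P =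
      ∫⁻ ω in E, ∫⁻ x, Φ (y + psum (seq X ω) (T ω), x) ∂(P.map (seq X)) ∂P := by
  obtain ⟨h1, h2⟩ := map_restrict_eq_prod hX hindep hident y hE
  have := Measure.isProbabilityMeasure_map (μ := P) (measurable_seq hX).aemeasurable
  rw [← lintegral_map' hΦ.aemeasurable h1, h2, lintegral_prod _ hΦ.aemeasurable,
    lintegral_map' hΦ.lintegral_prod_right'.aemeasurable h1.fst]

theorem integral_after [IsProbabilityMeasure P] (hX : ∀ i, Measurable (X i))
    (hindep : iIndepFun X P) (hident : ∀ i, IdentDistrib (X i) (X 0) P P) (y : ℝ) {E : Set Ω}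
    {T : Ω → ℕ} (hE : ∀ n, MeasurableSet[past X n] (E ∩ {ω | T ω = n}))
    {Φ : ℝ × (ℕ → ℝ) → ℝ} (hΦ : Measurable Φ)
    (hint : IntegrableOn (fun ω => Φ (y + psum (seq X ω) (T ω), shift (T ω) (seq X ω))) E P) :
    IntegrableOn (fun ω => ∫ x, Φ (y + psum (seq X ω) (T ω), x) ∂(P.map (seq X))) E P ∧
    ∫ ω in E, Φ (y + psum (seq X ω) (T ω), shift (T ω) (seq X ω)) ∂P =
      ∫ ω in E, ∫ x, Φ (y + psum (seq X ω) (T ω), x) ∂(P.map (seq X)) ∂P := by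
  obtain ⟨h1, h2⟩ := map_restrict_eq_prod hX hindep hident y hE
  have := Measure.isProbabilityMeasure_map (μ := P) (measurable_seq hX).aemeasurable
  have hsm := hΦ.stronglyMeasurable.aestronglyMeasurable
    (μ := (P.restrict E).map (fun ω => (y + psum (seq X ω) (T ω), shift (T ω) (seq X ω))))
  have hint' := (integrable_map_measure hsm h1).2 hint
  rw [h2] at hint'
  have hm := (hΦ.stronglyMeasurable.integral_prod_right'
    (ν := P.map (seq X))).aestronglyMeasurable
    (μ := (P.restrict E).map (fun ω => y + psum (seq X ω) (T ω)))
  constructor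
  · exact (integrable_map_measure hm h1.fst).1 hint'.integral_prod_left
  · rw [← integral_map h1 hsm, h2, integral_prod _ hint', integral_map h1.fst hm]

end StrongMarkov

/-- This is the compatibility condition of the strong Markov property for hitting times.
Intersecting with `Hits` is essential: on the other paths `hit` is `0`, which is not determined by
the past. -/
lemma measurableSet_past_hit {Ω : Type*} {X : ℕ → Ω → ℝ} {A : Set ℝ} (hA : MeasurableSet A)
    {n : ℕ} {D : Set Ω} (hD : MeasurableSet[past X n] D) (y : ℝ) (m : ℕ) :
    MeasurableSet[past X m]
      ((D ∩ {ω | Hits A n y (seq X ω)}) ∩ {ω | hit A n y (seq X ω) = m}) := by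
  by_cases hnm : n ≤ m
  · have hvisit : ∀ j ≤ m, MeasurableSet[past X m] {ω | y + psum (seq X ω) j ∈ A} := fun j hj =>
      ((@measurable_const _ _ _ (past X m) y).add (measurable_past_psum hj)) hA
    have : ((D ∩ {ω | Hits A n y (seq X ω)}) ∩ {ω | hit A n y (seq X ω) = m}) =
        (D ∩ {ω | y + psum (seq X ω) m ∈ A}) ∩
          ⋂ j, ⋂ (_ : n ≤ j ∧ j < m), {ω | y + psum (seq X ω) j ∈ A}ᶜ := by
      ext ω
      simp only [mem_inter_iff, mem_ofPred_eq, mem_iInter, mem_compl_iff]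
      constructor
      · rintro ⟨⟨h1, h2⟩, rfl⟩
        exact ⟨⟨h1, h2.mem⟩, fun j hj => notMem_of_lt_hit hj.1 hj.2⟩
      · rintro ⟨⟨h1, h2⟩, h3⟩
        exact ⟨⟨h1, m, hnm, h2⟩, hit_eq hnm h2 fun j hj hj' => h3 j ⟨hj, hj'⟩⟩
    rw [this]
    refine @MeasurableSet.inter _ (past X m) _ _ (@MeasurableSet.inter _ (past X m) _ _
      (past_mono hnm _ hD) (hvisit m le_rfl)) ?_
    exact @MeasurableSet.iInter _ _ (past X m) _ _ fun j =>
      @MeasurableSet.iInter _ _ (past X m) _ _ fun hj =>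
        @MeasurableSet.compl _ _ (past X m) (hvisit j hj.2.le)
  · have : ((D ∩ {ω | Hits A n y (seq X ω)}) ∩ {ω | hit A n y (seq X ω) = m}) = ∅ := by
      refine Set.eq_empty_of_forall_notMem ?_
      rintro ω ⟨⟨-, h2⟩, rfl⟩
      exact hnm h2.le
    rw [this]
    exact @MeasurableSet.empty _ (past X m)

/-! ### Ladder recursions under the law of the increments -/

/-- The coordinates of a sequence are independent and identically distributed under `Q`. -/
structure IsIID (Q : Measure (ℕ → ℝ)) : Prop where
  indep : iIndepFun (fun (i : ℕ) (x : ℕ → ℝ) => x i) Q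
  ident : ∀ i, IdentDistrib (fun x : ℕ → ℝ => x i) (fun x => x 0) Q Q

section Canonical

variable {Q : Measure (ℕ → ℝ)} [IsProbabilityMeasure Q]

/-- The coordinate process on sequences. -/
abbrev coord (i : ℕ) (x : ℕ → ℝ) : ℝ := x i

omit [IsProbabilityMeasure Q] in
lemma map_seq_coord : Q.map (seq coord) = Q := Measure.map_id

theorem IsIID.lintegral_after (hQ : IsIID Q) (z : ℝ) {E : Set (ℕ → ℝ)} {T : (ℕ → ℝ) → ℕ}
    (hE : ∀ n, MeasurableSet[past coord n] (E ∩ {x | T x = n})) (hfull : ∀ᵐ x ∂Q, x ∈ E)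
    {Φ : ℝ × (ℕ → ℝ) → ℝ≥0∞} (hΦ : Measurable Φ) :
    ∫⁻ x, Φ (z + psum x (T x), shift (T x) x) ∂Q =
      ∫⁻ x, ∫⁻ x', Φ (z + psum x (T x), x') ∂Q ∂Q := by
  have := RWStopping.lintegral_after (X := coord) (fun i => measurable_pi_apply i) hQ.indep
    hQ.ident z hE hΦ
  rwa [map_seq_coord, Measure.restrict_eq_self_of_ae_mem hfull] at this

theorem IsIID.integral_after (hQ : IsIID Q) (z : ℝ) {E : Set (ℕ → ℝ)} {T : (ℕ → ℝ) → ℕ}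
    (hE : ∀ n, MeasurableSet[past coord n] (E ∩ {x | T x = n})) (hfull : ∀ᵐ x ∂Q, x ∈ E)
    {Φ : ℝ × (ℕ → ℝ) → ℝ} (hΦ : Measurable Φ)
    (hint : Integrable (fun x => Φ (z + psum x (T x), shift (T x) x)) Q) :
    Integrable (fun x => ∫ x', Φ (z + psum x (T x), x') ∂Q) Q ∧
    ∫ x, Φ (z + psum x (T x), shift (T x) x) ∂Q =
      ∫ x, ∫ x', Φ (z + psum x (T x), x') ∂Q ∂Q := by
  have := RWStopping.integral_after (X := coord) (fun i => measurable_pi_apply i) hQ.indep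
    hQ.ident z hE hΦ hint.integrableOn
  rwa [map_seq_coord, IntegrableOn, Measure.restrict_eq_self_of_ae_mem hfull] at this

lemma measurableSet_past_ladder (n : ℕ) : MeasurableSet[past coord n]
    ({x | Hits (Ioi 0) 0 0 x} ∩ {x | ladder x = n}) := by
  have := measurableSet_past_hit (X := coord) (A := Ioi 0) measurableSet_Ioi (n := 0)
    (@MeasurableSet.univ _ (past coord 0)) 0 n
  rwa [Set.univ_inter] at this

-- A fixed jump size with positive probability makes the upward progress of the walk uniform in its
-- position.
omit [IsProbabilityMeasure Q] in
lemma exists_jump (hpos : 0 < Q {x | 0 < x 0}) : ∃ δ > 0, Q {x | δ < x 0} ≠ 0 := by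
  by_contra! hcon
  have : {x : ℕ → ℝ | 0 < x 0} = ⋃ n : ℕ, {x | 1 / ((n : ℝ) + 1) < x 0} := by
    ext x
    simp only [mem_ofPred_eq, mem_iUnion]
    exact ⟨fun hx => exists_nat_one_div_lt hx, fun ⟨n, hn⟩ => lt_trans (by positivity) hn⟩
  rw [this, measure_iUnion_null fun n => hcon _ (by positivity)] at hpos
  exact lt_irrefl _ hpos

/-- A locally bounded function that vanishes above a level and that, below it, exceeds its mean at
the next ladder height by at most `K`, grows at most linearly below the level. -/
theorem le_of_le_add_lintegral_ladder (hlad : ∀ᵐ x ∂Q, Hits (Ioi 0) 0 0 x) {δ : ℝ} (hδ : 0 < δ)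
    (hp : Q {x | δ < x 0} ≠ 0) {q : ℝ → ℝ≥0∞} {b : ℝ} {K : ℝ≥0∞} (h0 : ∀ z, b < z → q z = 0)
    (hrec : ∀ z ≤ b, q z ≤ K + ∫⁻ x, q (z + psum x (ladder x)) ∂Q)
    (hbdd : ∀ a, ∃ N ≠ ⊤, ∀ z, a < z → q z ≤ N) (j : ℕ) (z : ℝ) (hz : b - j * δ < z) :
    q z ≤ j * (K / Q {x | δ < x 0}) := by
  set D : Set (ℕ → ℝ) := {x | δ < x 0} with hDdef
  have hDm : MeasurableSet D := measurableSet_lt measurable_const (measurable_pi_apply 0)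
  induction j generalizing z with
  | zero => simp [h0 z (by simpa using hz)]
  | succ j ih =>
    set M : ℝ≥0∞ := j * (K / Q D)
    set a : ℝ := b - (j + 1 : ℕ) * δ with ha
    obtain ⟨N, hN, hqN⟩ := hbdd a
    set s : ℝ≥0∞ := ⨆ z : Ioi a, q z
    have hqs : ∀ z, a < z → q z ≤ s := fun z hz => le_iSup (fun z : Ioi a => q z) ⟨z, hz⟩
    have hs : s ≠ ⊤ := ne_top_of_le_ne_top hN (iSup_le fun z => hqN z z.2)
    -- A first increment above `δ` is already the first ladder height and lifts the walk above `b -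
    -- j * δ`, where the induction hypothesis gives `M`; otherwise the ladder height still lies
    -- above `a`, where `q ≤ s`.
    have hkey : ∀ z, a < z → q z ≤ K + (M * Q D + s * Q Dᶜ) := by
      intro z hz
      rcases lt_or_ge b z with hbz | hzb
      · simp [h0 z hbz]
      refine (hrec z hzb).trans (add_le_add le_rfl ?_)
      calc ∫⁻ x, q (z + psum x (ladder x)) ∂Q
          ≤ ∫⁻ x, (D.indicator (fun _ => M) x + Dᶜ.indicator (fun _ => s) x) ∂Q := by
            refine lintegral_mono_ae ?_
            filter_upwards [hlad] with x hx
            by_cases hxD : x ∈ D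
            · have hx0 : δ < x 0 := hxD
              simp only [hxD, indicator_of_mem, mem_compl_iff, not_true_eq_false,
                not_false_eq_true, indicator_of_notMem, add_zero]
              refine ih _ ?_
              rw [ladder_eq_one (hδ.trans hx0), psum_one]
              push_cast at ha
              linarith
            · simp only [hxD, mem_compl_iff, not_false_eq_true, indicator_of_notMem,
                indicator_of_mem, zero_add]
              exact hqs _ (by linarith [(ladder_spec hx).1])
        _ = M * Q D + s * Q Dᶜ := by
            rw [lintegral_add_left (measurable_const.indicator hDm), lintegral_indicator hDm,
              lintegral_indicator hDm.compl]
            simp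
    have hs' : s ≤ K + (M * Q D + s * Q Dᶜ) := iSup_le fun z => hkey z z.2
    -- Subtracting `s * Q Dᶜ` requires `s` to be finite; this is where local boundedness enters.
    have hcancel : s * Q D ≤ K + M * Q D := by
      have hfin : s * Q Dᶜ ≠ ⊤ := ENNReal.mul_ne_top hs (measure_ne_top _ _)
      refine (ENNReal.add_le_add_iff_right hfin).1 ?_
      rw [← mul_add, measure_add_measure_compl hDm, measure_univ, mul_one, add_assoc]
      exact hs'
    have hpt : Q D ≠ ⊤ := measure_ne_top _ _
    calc q z ≤ s := hqs z hz
      _ ≤ (K + M * Q D) / Q D := (ENNReal.le_div_iff_mul_le (Or.inl hp) (Or.inl hpt)).2 hcancel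
      _ = (j + 1 : ℕ) * (K / Q D) := by
        rw [ENNReal.add_div, ENNReal.mul_div_cancel_right hp hpt]
        push_cast
        ring

variable {A : Set ℝ} {b : ℝ} {h : ℝ → ℝ}

theorem ae_hits (hQ : IsIID Q) (hlad : ∀ᵐ x ∂Q, Hits (Ioi 0) 0 0 x) (hpos : 0 < Q {x | 0 < x 0})
    (hA : IsUpperSet A) (hb : Ioi b ⊆ A) (z : ℝ) : ∀ᵐ x ∂Q, Hits A 0 z x := by
  have hAm : MeasurableSet A := hA.ordConnected.measurableSet
  obtain ⟨δ, hδ, hp⟩ := exists_jump hpos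
  -- The probability of never visiting `A`. It satisfies the ladder recursion with `K = 0`, so the
  -- growth bound forces it to vanish.
  set q : ℝ → ℝ≥0∞ := fun z => ∫⁻ x, {p : ℝ × (ℕ → ℝ) | Hits A 0 p.1 p.2}ᶜ.indicator 1 (z, x) ∂Q
  have hm : Measurable ({p : ℝ × (ℕ → ℝ) | Hits A 0 p.1 p.2}ᶜ.indicator (1 : ℝ × (ℕ → ℝ) → ℝ≥0∞)) :=
    measurable_one.indicator (measurableSet_hits hAm 0).compl
  have hq0 : ∀ z ∈ A, q z = 0 := fun z hz => by
    have : ∀ x, Hits A 0 z x := fun x => ⟨0, le_rfl, by simpa using hz⟩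
    simp [q, this]
  have hq1 : ∀ z, q z ≤ 1 := fun z => by
    calc q z ≤ ∫⁻ _, 1 ∂Q := lintegral_mono fun x => indicator_le_self' (by simp) _
      _ = 1 := by simp
  obtain ⟨j, hj⟩ : ∃ j : ℕ, b - j * δ < z := by
    obtain ⟨j, hj⟩ := exists_nat_gt ((b - z) / δ)
    exact ⟨j, by rw [div_lt_iff₀ hδ] at hj; linarith⟩
  have hqz : q z = 0 := by
    refine le_antisymm ?_ zero_le
    refine (le_of_le_add_lintegral_ladder hlad hδ hp (K := 0) (fun z hz => hq0 z (hb hz))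
      (fun z _ => ?_) (fun a => ⟨1, by simp, fun z _ => hq1 z⟩) j z hj).trans (by simp)
    by_cases hz : z ∈ A
    · simp [hq0 z hz]
    rw [zero_add, ← hQ.lintegral_after z measurableSet_past_ladder hlad hm]
    refine lintegral_mono_ae ?_
    filter_upwards [hlad] with x hx
    by_cases hx' : Hits A 0 (z + psum x (ladder x)) (shift (ladder x) x)
    · have : Hits A 0 z x := hx'.of_shift (Nat.zero_le _)
      simp [this]
    · rw [indicator_of_mem (a := (z + psum x (ladder x), shift (ladder x) x)) (by exact hx')]
      exact indicator_le_self' (by simp) _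
  filter_upwards [(lintegral_eq_zero_iff (hm.comp (measurable_prodMk_left (x := z)))).1 hqz] with x hx
  by_contra hcon
  simp [hcon] at hx

theorem lintegral_pathCost_hit_le (hQ : IsIID Q) (hlad : ∀ᵐ x ∂Q, Hits (Ioi 0) 0 0 x)
    (hpos : 0 < Q {x | 0 < x 0}) {δ : ℝ} (hδ : 0 < δ)
    (hp : Q {x | δ < x 0} ≠ 0) (hA : IsUpperSet A) (hb : Ioi b ⊆ A) (hh : Measurable h)
    (hh0 : ∀ x, 0 ≤ h x) {K : ℝ≥0∞}
    (hK : ∀ z ≤ b, ∫⁻ x, ENNReal.ofReal (pathCost h z (ladder x) x) ∂Q ≤ K)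
    (j : ℕ) (z : ℝ) (hz : b - j * δ < z) :
    ∫⁻ x, ENNReal.ofReal (pathCost h z (hit A 0 z x) x) ∂Q ≤ j * (K / Q {x | δ < x 0}) := by
  have hAm : MeasurableSet A := hA.ordConnected.measurableSet
  set C : ℝ × (ℕ → ℝ) → ℝ≥0∞ := fun p => ENNReal.ofReal (pathCost h p.1 (hit A 0 p.1 p.2) p.2)
    with hC
  have hCm : Measurable C := (measurable_pathCost_at hh (measurable_hit hAm 0)).ennreal_ofReal
  have hC0 : ∀ z ∈ A, ∀ x, C (z, x) = 0 := fun z hz x => by simp [hC, hit_zero_of_mem hz]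
  -- Truncation supplies the local boundedness that the growth bound demands. The bound does not
  -- depend on `N`, so monotone convergence removes the truncation.
  have hN : ∀ N : ℕ, ∫⁻ x, min (C (z, x)) N ∂Q ≤ j * (K / Q {x | δ < x 0}) := by
    intro N
    have hm : Measurable fun p => min (C p) N := hCm.min measurable_const
    refine le_of_le_add_lintegral_ladder (q := fun z => ∫⁻ x, min (C (z, x)) N ∂Q) hlad hδ hp
      (fun z hz => by simp [hC0 z (hb hz)]) (fun z hzb => ?_)
      (fun a => ⟨N, ENNReal.natCast_ne_top N, fun z _ => ?_⟩) j z hz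
    · by_cases hzA : z ∈ A
      · simp [hC0 z hzA]
      rw [← hQ.lintegral_after z measurableSet_past_ladder hlad hm]
      refine le_trans ?_ (add_le_add (hK z hzb) le_rfl)
      rw [← lintegral_add_right _ (by
        exact hm.comp ((measurable_const.add (measurable_psum_at measurable_id
          measurable_ladder)).prodMk (measurable_shift_at measurable_id measurable_ladder)))]
      refine lintegral_mono_ae ?_
      filter_upwards [hlad, ae_hits hQ hlad hpos hA hb z] with x hx hx'
      have : C (z, x) = ENNReal.ofReal (pathCost h z (ladder x) x) +
          C (z + psum x (ladder x), shift (ladder x) x) := by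
        simp only [hC]
        rw [hit_eq_add hx' (Nat.zero_le (ladder x))
          (fun i _ hi => notMem_of_lt_ladder hA hzA hx hi), pathCost_add,
          ENNReal.ofReal_add (pathCost_nonneg hh0 _ _ _) (pathCost_nonneg hh0 _ _ _)]
      rw [this]
      rcases le_total (C (z + psum x (ladder x), shift (ladder x) x)) N with hle | hle
      · rw [min_eq_left hle]
        exact min_le_left _ _
      · rw [min_eq_right hle]
        exact (min_le_right _ _).trans le_add_self
    · calc ∫⁻ x, min (C (z, x)) N ∂Q ≤ ∫⁻ _, N ∂Q := lintegral_mono fun x => min_le_right _ _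
        _ = N := by simp
  have hsup : ∀ x, C (z, x) = ⨆ N : ℕ, min (C (z, x)) N := fun x => by
    rw [← inf_iSup_eq, ENNReal.iSup_natCast, inf_top_eq]
  change ∫⁻ x, C (z, x) ∂Q ≤ _
  have hm : ∀ N : ℕ, Measurable fun x => min (C (z, x)) N := fun N =>
    (hCm.comp (measurable_prodMk_left (x := z))).min measurable_const
  rw [lintegral_congr hsup, lintegral_iSup hm
    (fun M N hMN x => min_le_min le_rfl (by exact_mod_cast hMN))]
  exact iSup_le hN

end Canonical

/-! ### Supremal gains and the effect of concavity -/

/-- The largest gain over stopping at once that the path started in `z` offers. -/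
noncomputable def supGain (γ h : ℝ → ℝ) (z : ℝ) (x : ℕ → ℝ) : ℝ≥0∞ :=
  ⨆ n, ENNReal.ofReal (pathReward γ h z n x - γ z)

/-- The optimal stopping problem, formulated in terms of the law `Q` of the increments. -/
structure LadderModel (Q : Measure (ℕ → ℝ)) (γ h : ℝ → ℝ) : Prop where
  iid : IsIID Q
  pos : 0 < Q {x | 0 < x 0}
  hits : ∀ᵐ x ∂Q, Hits (Ioi 0) 0 0 x
  mono_payoff : Monotone γ
  mono_cost : Monotone h
  cost_nonneg : ∀ x, 0 ≤ h x
  integrable_ladder : Integrable (fun x => (ladder x : ℝ)) Q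
  integrable_payoff : ∀ z, Integrable (fun x => γ (z + psum x (ladder x))) Q
  integrable_cost : ∀ z, Integrable (fun x => pathCost h z (ladder x) x) Q
  supGain_ne_top : ∀ z, ∫⁻ x, supGain γ h z x ∂Q ≠ ⊤

lemma ofReal_integral_le_lintegral {α : Type*} [MeasurableSpace α] {μ : Measure α} (f : α → ℝ) :
    ENNReal.ofReal (∫ a, f a ∂μ) ≤ ∫⁻ a, ENNReal.ofReal (f a) ∂μ := by
  by_cases hf : Integrable f μ
  · refine ENNReal.ofReal_le_of_le_toReal ?_
    rw [integral_eq_lintegral_pos_part_sub_lintegral_neg_part hf]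
    exact sub_le_self _ ENNReal.toReal_nonneg
  · simp [integral_undef hf]

lemma Hits.start_le {A : Set ℝ} {z : ℝ} {x : ℕ → ℝ} (hA : IsUpperSet A) (hx : Hits A 0 z x) :
    z ≤ z + psum x (hit A 0 z x) := by
  by_cases hz : z ∈ A
  · simp [hit_zero_of_mem hz]
  · by_contra! hcon
    exact hz (hA hcon.le hx.mem)

section SupGain

variable {γ h : ℝ → ℝ}

lemma measurable_supGain (hγ : Measurable γ) (hh : Measurable h) (z : ℝ) :
    Measurable (supGain γ h z) :=
  Measurable.iSup fun n => (((measurable_pathReward hγ hh n).comp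
    (measurable_prodMk_left (x := z))).sub measurable_const).ennreal_ofReal

lemma pathReward_sub_le {z : ℝ} {x : ℕ → ℝ} (hx : supGain γ h z x ≠ ⊤) (n : ℕ) :
    pathReward γ h z n x - γ z ≤ (supGain γ h z x).toReal :=
  (ENNReal.ofReal_le_iff_le_toReal hx).1 (le_iSup (fun n => ENNReal.ofReal
    (pathReward γ h z n x - γ z)) n)

/-- If the payoff is concave from `b` on, then the gain at a fixed time at which the path has risen
is largest at `b`. -/
lemma pathReward_sub_anti (hh : Monotone h) {b z : ℝ} (hconc : ConcaveOn ℝ (Ici b) γ)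
    (hz : b ≤ z) {n : ℕ} {x : ℕ → ℝ} (hs : 0 < psum x n) :
    pathReward γ h z n x - γ z ≤ pathReward γ h b n x - γ b := by
  have h1 := pathCost_mono_start hh hz n x
  have h2 : γ (z + psum x n) + γ b ≤ γ (b + psum x n) + γ z := by
    rcases hz.eq_or_lt with rfl | hlt
    · linarith
    set s := psum x n
    set d := z - b with hd
    have hd0 : 0 < d := by linarith
    have hb : b ∈ Ici b := mem_Ici.2 le_rfl
    have hzs : z + s ∈ Ici b := by simp only [mem_Ici]; linarith
    -- Both `z` and `b + s` are convex combinations of `b` and `z + s`, with the two weights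
    -- interchanged; adding the two concavity inequalities makes the weights sum to one.
    have e1 := hconc.2 hb hzs (show (0 : ℝ) ≤ s / (d + s) by positivity)
      (show (0 : ℝ) ≤ d / (d + s) by positivity) (by field_simp; ring)
    have e2 := hconc.2 hb hzs (show (0 : ℝ) ≤ d / (d + s) by positivity)
      (show (0 : ℝ) ≤ s / (d + s) by positivity) (by field_simp)
    have hne : d + s ≠ 0 := by positivity
    have p1 : (s / (d + s)) • b + (d / (d + s)) • (z + s) = z := by
      simp only [smul_eq_mul]
      field_simp
      rw [hd]; ring
    have p2 : (d / (d + s)) • b + (s / (d + s)) • (z + s) = b + s := by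
      simp only [smul_eq_mul]
      field_simp
      rw [hd]; ring
    rw [p1] at e1
    rw [p2] at e2
    have q : d / (d + s) + s / (d + s) = 1 := by field_simp
    simp only [smul_eq_mul] at e1 e2
    have : (s / (d + s) * γ b + d / (d + s) * γ (z + s)) +
        (d / (d + s) * γ b + s / (d + s) * γ (z + s)) = γ b + γ (z + s) := by
      linear_combination (γ b + γ (z + s)) * q
    linarith
  simp only [pathReward]
  linarith

/-- If the payoff is concave from `b` on, then the possible gains are largest at `b`. -/
lemma supGain_le (hγ : Monotone γ) (hh : Monotone h) (hh0 : ∀ x, 0 ≤ h x) {b z : ℝ}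
    (hconc : ConcaveOn ℝ (Ici b) γ) (hz : b ≤ z) (x : ℕ → ℝ) :
    supGain γ h z x ≤ supGain γ h b x := by
  refine iSup_le fun n => ?_
  rcases le_or_gt (psum x n) 0 with hs | hs
  · have h1 : γ (z + psum x n) ≤ γ z := hγ (by linarith)
    rw [ENNReal.ofReal_of_nonpos]
    · exact zero_le
    · have := pathCost_nonneg hh0 z n x
      simp only [pathReward]
      linarith
  · exact (ENNReal.ofReal_le_ofReal (pathReward_sub_anti hh hconc hz hs)).trans
      (le_iSup (fun n => ENNReal.ofReal (pathReward γ h b n x - γ b)) n)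

end SupGain

/-! ### Waiting for the stopping set and returning to it -/

namespace LadderModel

variable {Q : Measure (ℕ → ℝ)} [IsProbabilityMeasure Q] {γ h : ℝ → ℝ} {A : Set ℝ} {b : ℝ}

omit [IsProbabilityMeasure Q] in
lemma ae_supGain_ne_top (M : LadderModel Q γ h) (z : ℝ) : ∀ᵐ x ∂Q, supGain γ h z x ≠ ⊤ := by
  filter_upwards [ae_lt_top (measurable_supGain M.mono_payoff.measurable M.mono_cost.measurable z)
    (M.supGain_ne_top z)] with x hx using hx.ne

/-- From above the reward is controlled by the integrable supremal gain, from below by `c` minus the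
integrable cost. -/
lemma integrable_pathReward (M : LadderModel Q γ h) (z : ℝ) {T : (ℕ → ℝ) → ℕ} (hT : Measurable T)
    (hC : Integrable (fun x => pathCost h z (T x) x) Q) {c : ℝ}
    (hc : ∀ᵐ x ∂Q, c ≤ γ (z + psum x (T x))) :
    Integrable (fun x => pathReward γ h z (T x) x) Q := by
  have hγ := M.mono_payoff.measurable
  have hh := M.mono_cost.measurable
  have hG : Integrable (fun x => (supGain γ h z x).toReal) Q :=
    integrable_toReal_of_lintegral_ne_top (measurable_supGain hγ hh z).aemeasurable
      (M.supGain_ne_top z)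
  refine Integrable.mono' ((hG.add (integrable_const (|γ z| + |c|))).add hC) ?_ ?_
  · exact ((measurable_pathReward_at hγ hh (hT.comp measurable_snd)).comp
      (measurable_prodMk_left (x := z))).aestronglyMeasurable
  · filter_upwards [M.ae_supGain_ne_top z, hc] with x hx hcx
    have h1 := pathReward_sub_le hx (T x)
    have h2 := pathCost_nonneg M.cost_nonneg z (T x) x
    have h3 : 0 ≤ (supGain γ h z x).toReal := ENNReal.toReal_nonneg
    simp only [Pi.add_apply, Real.norm_eq_abs]
    rw [abs_le]
    constructor
    · have : c - pathCost h z (T x) x ≤ pathReward γ h z (T x) x := by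
        simp only [pathReward]; linarith
      linarith [neg_abs_le c, abs_nonneg (γ z)]
    · linarith [le_abs_self (γ z), abs_nonneg c]

/-- The cost function `k` is kept general: `k = h` yields the running cost and `k = 1` the hitting
time itself. Monotonicity makes the ladder cost at `b` a uniform bound for the ladder costs below
`b`. -/
lemma exists_bound_cost (M : LadderModel Q γ h) (hA : IsUpperSet A) (hb : Ioi b ⊆ A) {k : ℝ → ℝ}
    (hk : Monotone k) (hk0 : ∀ x, 0 ≤ k x)
    (hint : Integrable (fun x => pathCost k b (ladder x) x) Q) (a : ℝ) :
    ∃ N ≠ ⊤, ∀ z, a < z → ∫⁻ x, ENNReal.ofReal (pathCost k z (hit A 0 z x) x) ∂Q ≤ N := by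
  obtain ⟨δ, hδ, hp⟩ := exists_jump M.pos
  obtain ⟨j, hj⟩ : ∃ j : ℕ, b - j * δ < a := by
    obtain ⟨j, hj⟩ := exists_nat_gt ((b - a) / δ)
    exact ⟨j, by rw [div_lt_iff₀ hδ] at hj; linarith⟩
  have hK : ∫⁻ x, ENNReal.ofReal (pathCost k b (ladder x) x) ∂Q ≠ ⊤ := by
    rw [← ofReal_integral_eq_lintegral_ofReal hint
      (ae_of_all _ fun x => pathCost_nonneg hk0 _ _ _)]
    exact ENNReal.ofReal_ne_top
  refine ⟨_, ?_, fun z hz => lintegral_pathCost_hit_le M.iid M.hits M.pos hδ hp hA hb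
    hk.measurable hk0 (fun z hz => lintegral_mono fun x => ENNReal.ofReal_le_ofReal
      (pathCost_mono_start hk hz _ _)) j z (hj.trans hz)⟩
  exact ENNReal.mul_ne_top (ENNReal.natCast_ne_top j) (ENNReal.div_ne_top hK hp)

lemma integrable_cost_hit_aux (M : LadderModel Q γ h) (hA : IsUpperSet A) (hb : Ioi b ⊆ A)
    {k : ℝ → ℝ} (hk : Monotone k) (hk0 : ∀ x, 0 ≤ k x)
    (hint : Integrable (fun x => pathCost k b (ladder x) x) Q) (z : ℝ) :
    Integrable (fun x => pathCost k z (hit A 0 z x) x) Q := by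
  obtain ⟨N, hN, hle⟩ := M.exists_bound_cost hA hb hk hk0 hint (z - 1)
  have hm := (measurable_pathCost_at hk.measurable
    (measurable_hit hA.ordConnected.measurableSet 0)).comp (measurable_prodMk_left (x := z))
  refine ⟨hm.aestronglyMeasurable, ?_⟩
  rw [hasFiniteIntegral_iff_ofReal (ae_of_all _ fun x => pathCost_nonneg hk0 _ _ _)]
  exact (hle z (by linarith)).trans_lt hN.lt_top

lemma integrable_cost_hit (M : LadderModel Q γ h) (hA : IsUpperSet A) (hb : Ioi b ⊆ A) (z : ℝ) :
    Integrable (fun x => pathCost h z (hit A 0 z x) x) Q :=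
  M.integrable_cost_hit_aux hA hb M.mono_cost M.cost_nonneg (M.integrable_cost b) z

lemma integrable_hit (M : LadderModel Q γ h) (hA : IsUpperSet A) (hb : Ioi b ⊆ A) (z : ℝ) :
    Integrable (fun x => (hit A 0 z x : ℝ)) Q := by
  have := M.integrable_cost_hit_aux hA hb (k := fun _ => 1) monotone_const (fun _ => zero_le_one)
    (by simpa [pathCost] using M.integrable_ladder) z
  simpa [pathCost] using this

lemma ae_hits (M : LadderModel Q γ h) (hA : IsUpperSet A) (hb : Ioi b ⊆ A) (z : ℝ) :
    ∀ᵐ x ∂Q, Hits A 0 z x :=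
  RWStopping.ae_hits M.iid M.hits M.pos hA hb z

lemma integrable_reward_hit (M : LadderModel Q γ h) (hA : IsUpperSet A) (hb : Ioi b ⊆ A) (z : ℝ) :
    Integrable (fun x => pathReward γ h z (hit A 0 z x) x) Q := by
  refine M.integrable_pathReward z ((measurable_hit hA.ordConnected.measurableSet 0).comp
    (measurable_prodMk_left (x := z))) (M.integrable_cost_hit hA hb z) (c := γ z) ?_
  filter_upwards [M.ae_hits hA hb z] with x hx using M.mono_payoff (hx.start_le hA)

omit [IsProbabilityMeasure Q] in
lemma integrable_reward_ladder (M : LadderModel Q γ h) (z : ℝ) :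
    Integrable (fun x => pathReward γ h z (ladder x) x) Q :=
  (M.integrable_payoff z).sub (M.integrable_cost z)

/-- If waiting for the next ladder time is favourable outside of `A`, then so is waiting until `A`
is reached; the reward may include a bonus `c` per unit of time. -/
theorem le_integral_reward_hit (M : LadderModel Q γ h) (hA : IsUpperSet A) (hb : Ioi b ⊆ A) {c : ℝ}
    (hc : 0 ≤ c)
    (hgain : ∀ z ∉ A, γ z ≤ ∫ x, (pathReward γ h z (ladder x) x + c * ladder x) ∂Q) (z : ℝ) :
    γ z ≤ ∫ x, (pathReward γ h z (hit A 0 z x) x + c * hit A 0 z x) ∂Q := by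
  have hAm : MeasurableSet A := hA.ordConnected.measurableSet
  obtain ⟨δ, hδ, hp⟩ := exists_jump M.pos
  set D : ℝ × (ℕ → ℝ) → ℝ := fun p =>
    γ p.1 - (pathReward γ h p.1 (hit A 0 p.1 p.2) p.2 + c * hit A 0 p.1 p.2) with hD
  have hDm : Measurable D := by
    have h1 := measurable_pathReward_at M.mono_payoff.measurable M.mono_cost.measurable
      (measurable_hit hAm 0)
    have h2 : Measurable fun p : ℝ × (ℕ → ℝ) => (hit A 0 p.1 p.2 : ℝ) :=
      measurable_from_top.comp (measurable_hit hAm 0)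
    exact (M.mono_payoff.measurable.comp measurable_fst).sub (h1.add (h2.const_mul c))
  have hLi : ∀ z, Integrable
      (fun x => pathReward γ h z (hit A 0 z x) x + c * hit A 0 z x) Q := fun z =>
    (M.integrable_reward_hit hA hb z).add ((M.integrable_hit hA hb z).const_mul c)
  have hDi : ∀ z, Integrable (fun x => D (z, x)) Q := fun z =>
    (integrable_const (γ z)).sub (hLi z)
  have hD0 : ∀ z ∈ A, ∀ x, D (z, x) = 0 := fun z hz x => by simp [hD, hit_zero_of_mem hz]
  obtain ⟨j, hj⟩ : ∃ j : ℕ, b - j * δ < z := by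
    obtain ⟨j, hj⟩ := exists_nat_gt ((b - z) / δ)
    exact ⟨j, by rw [div_lt_iff₀ hδ] at hj; linarith⟩
  -- `D` is the loss from waiting for `A`. Since the ladder gain is non-negative off `A`, the
  -- positive part of the mean loss satisfies the ladder recursion with `K = 0`.
  have hq : ENNReal.ofReal (∫ x, D (z, x) ∂Q) = 0 := by
    refine le_antisymm ?_ zero_le
    refine (le_of_le_add_lintegral_ladder (q := fun z => ENNReal.ofReal (∫ x, D (z, x) ∂Q))
      M.hits hδ hp (K := 0) (fun z hz => by simp [hD0 z (hb hz)]) (fun z _ => ?_)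
      (fun a => ?_) j z hj).trans (by simp)
    · by_cases hz : z ∈ A
      · simp [hD0 z hz]
      rw [zero_add]
      refine le_trans (ENNReal.ofReal_le_ofReal ?_) (ofReal_integral_le_lintegral _)
      -- From `z ∉ A` the upper set `A` is not entered before the ladder time, so waiting for `A`
      -- passes through it.
      have hsplit : (fun x => D (z + psum x (ladder x), shift (ladder x) x)) =ᵐ[Q]
          fun x => D (z, x) + (pathReward γ h z (ladder x) x + c * ladder x - γ z) := by
        filter_upwards [M.hits, M.ae_hits hA hb z] with x hx hx'
        have hh := hit_eq_add hx' (Nat.zero_le (ladder x))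
          (fun i _ hi => notMem_of_lt_ladder hA hz hx hi)
        simp only [hD]
        rw [hh, pathReward_add]
        push_cast
        ring
      have hli : Integrable (fun x => pathReward γ h z (ladder x) x + c * ladder x) Q :=
        (M.integrable_reward_ladder z).add (M.integrable_ladder.const_mul c)
      have hls : Integrable (fun x => pathReward γ h z (ladder x) x + c * ladder x - γ z) Q :=
        hli.sub (integrable_const (γ z))
      have hi2 := (hDi z).add hls
      obtain ⟨-, h2⟩ := M.iid.integral_after z measurableSet_past_ladder M.hits hDm
        (hi2.congr hsplit.symm)
      rw [← h2, integral_congr_ae hsplit,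
        integral_add (hDi z) hls, integral_sub hli (integrable_const (γ z))]
      have := hgain z hz
      simp only [integral_const, probReal_univ, smul_eq_mul, one_mul]
      linarith
    -- Entering the upper set `A` does not lower the payoff and the bonus is non-negative, so the
    -- loss is at most the running cost.
    · obtain ⟨N, hN, hle⟩ := M.exists_bound_cost hA hb M.mono_cost M.cost_nonneg
        (M.integrable_cost b) a
      refine ⟨N, hN, fun z hz => (ofReal_integral_le_lintegral _).trans
        (le_trans (lintegral_mono_ae ?_) (hle z hz))⟩
      filter_upwards [M.ae_hits hA hb z] with x hx
      refine ENNReal.ofReal_le_ofReal ?_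
      have h1 := M.mono_payoff (hx.start_le hA)
      have h2 : 0 ≤ c * (hit A 0 z x : ℝ) := by positivity
      simp only [hD, pathReward]
      linarith
  rw [ENNReal.ofReal_eq_zero] at hq
  have : ∫ x, D (z, x) ∂Q = γ z -
      ∫ x, (pathReward γ h z (hit A 0 z x) x + c * hit A 0 z x) ∂Q := by
    simp only [hD]
    rw [integral_sub (integrable_const _) (hLi z)]
    simp
  linarith

-- The first ladder height lies above `y`, hence in the upper set `A`.
omit [IsProbabilityMeasure Q] in
lemma ae_hits_return (M : LadderModel Q γ h) (hA : IsUpperSet A) {y : ℝ} (hy : y ∈ A) :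
    ∀ᵐ x ∂Q, Hits A 1 y x ∧ hit A 1 y x ≤ ladder x := by
  filter_upwards [M.hits] with x hx
  have h1 : y + psum x (ladder x) ∈ A := hA (by linarith [(ladder_spec hx).1]) hy
  exact ⟨⟨_, ladder_pos hx, h1⟩, hit_le (ladder_pos hx) h1⟩

lemma integrable_reward_return (M : LadderModel Q γ h) (hA : IsUpperSet A) {a : ℝ} (ha : A ⊆ Ici a)
    {y : ℝ} (hy : y ∈ A) : Integrable (fun x => pathReward γ h y (hit A 1 y x) x) Q := by
  have hAm : MeasurableSet A := hA.ordConnected.measurableSet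
  have hT : Measurable fun x => hit A 1 y x :=
    (measurable_hit hAm 1).comp (measurable_prodMk_left (x := y))
  refine M.integrable_pathReward y hT ?_ (c := γ a) ?_
  · refine (M.integrable_cost y).mono' ((measurable_pathCost_at M.mono_cost.measurable
      (measurable_hit hAm 1)).comp (measurable_prodMk_left (x := y))).aestronglyMeasurable ?_
    filter_upwards [M.ae_hits_return hA hy] with x hx
    rw [Real.norm_of_nonneg (pathCost_nonneg M.cost_nonneg _ _ _)]
    exact pathCost_mono_time M.cost_nonneg y hx.2 x
  · filter_upwards [M.ae_hits_return hA hy] with x hx using M.mono_payoff (ha hx.1.mem)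

/-- In `A`, stopping at once is at least as good as stopping at the next visit to `A`. -/
theorem integral_reward_return_le (M : LadderModel Q γ h) (hA : IsUpperSet A) {a : ℝ}
    (ha : A ⊆ Ici a) {y : ℝ} (hy : y ∈ A) {c : ℝ} (hc : 0 ≤ c)
    (hy_le : ∫ x, (pathReward γ h y (ladder x) x + c * ladder x) ∂Q ≤ γ y)
    (hgain : ∀ z ≤ y, γ z ≤ ∫ x, (pathReward γ h z (ladder x) x + c * ladder x) ∂Q) :
    ∫ x, pathReward γ h y (hit A 1 y x) x ∂Q ≤ γ y := by
  have hAm : MeasurableSet A := hA.ordConnected.measurableSet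
  -- The gain, bonus included, from continuing until the level `y` is exceeded. Its mean is
  -- non-negative from every starting point, by the waiting inequality for the set `Ioi y`.
  set Φ : ℝ × (ℕ → ℝ) → ℝ := fun p =>
    (pathReward γ h p.1 (hit (Ioi y) 0 p.1 p.2) p.2 + c * hit (Ioi y) 0 p.1 p.2) - γ p.1 with hΦ
  have hΦm : Measurable Φ := by
    have h1 := measurable_pathReward_at M.mono_payoff.measurable M.mono_cost.measurable
      (measurable_hit (measurableSet_Ioi (a := y)) 0)
    have h2 : Measurable fun p : ℝ × (ℕ → ℝ) => (hit (Ioi y) 0 p.1 p.2 : ℝ) :=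
      measurable_from_top.comp (measurable_hit measurableSet_Ioi 0)
    exact (h1.add (h2.const_mul c)).sub (M.mono_payoff.measurable.comp measurable_fst)
  have hΦ0 : ∀ z, 0 ≤ ∫ x, Φ (z, x) ∂Q := fun z => by
    have h1 := M.le_integral_reward_hit (isUpperSet_Ioi y) subset_rfl hc
      (fun z hz => hgain z (not_lt.1 hz)) z
    have h2 : Integrable (fun x => pathReward γ h z (hit (Ioi y) 0 z x) x +
        c * hit (Ioi y) 0 z x) Q :=
      (M.integrable_reward_hit (isUpperSet_Ioi y) subset_rfl z).add
        ((M.integrable_hit (isUpperSet_Ioi y) subset_rfl z).const_mul c)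
    simp only [hΦ]
    rw [integral_sub h2 (integrable_const _)]
    simpa using h1
  have hρi := M.integrable_reward_return hA ha hy
  have hli : Integrable (fun x => pathReward γ h y (ladder x) x + c * ladder x) Q :=
    (M.integrable_reward_ladder y).add (M.integrable_ladder.const_mul c)
  have hti : Integrable (fun x => (hit A 1 y x : ℝ)) Q := by
    refine M.integrable_ladder.mono' (measurable_from_top.comp ((measurable_hit hAm 1).comp
      (measurable_prodMk_left (x := y)))).aestronglyMeasurable ?_
    filter_upwards [M.ae_hits_return hA hy] with x hx
    simpa using hx.2
  have hbonus : Integrable (fun x => pathReward γ h y (hit A 1 y x) x + c * hit A 1 y x) Q :=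
    hρi.add (hti.const_mul c)
  -- The return to `A` comes no later than the ladder time, which is the first passage above `y`; so
  -- `Φ` after the return is the difference of the two rewards with bonus.
  have hsplit : (fun x => Φ (y + psum x (hit A 1 y x), shift (hit A 1 y x) x)) =ᵐ[Q]
      fun x => (pathReward γ h y (ladder x) x + c * ladder x) -
        (pathReward γ h y (hit A 1 y x) x + c * hit A 1 y x) := by
    filter_upwards [M.hits, M.ae_hits_return hA hy, M.ae_hits (isUpperSet_Ioi y) subset_rfl y]
      with x hx hx' hx''
    have hh := hit_eq_add hx'' (Nat.zero_le (hit A 1 y x)) (fun i _ hi =>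
      notMem_of_lt_ladder (isUpperSet_Ioi y) (by simp) hx (hi.trans_le hx'.2))
    rw [← ladder_eq_hit] at hh
    simp only [hΦ]
    rw [hh, pathReward_add]
    push_cast
    ring
  have hfull : ∀ᵐ x ∂Q, x ∈ univ ∩ {x | Hits A 1 y (seq coord x)} := by
    filter_upwards [M.ae_hits_return hA hy] with x hx using ⟨trivial, hx.1⟩
  obtain ⟨-, h2⟩ := M.iid.integral_after y (T := fun x => hit A 1 y x)
    (measurableSet_past_hit (X := coord) hAm (@MeasurableSet.univ _ (past coord 1)) y) hfull hΦm
    ((hli.sub hbonus).congr hsplit.symm)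
  rw [integral_congr_ae hsplit, integral_sub hli hbonus] at h2
  have h3 : 0 ≤ ∫ x, ∫ x', Φ (y + psum x (hit A 1 y x), x') ∂Q ∂Q :=
    integral_nonneg fun x => hΦ0 _
  have h4 : ∫ x, pathReward γ h y (hit A 1 y x) x ∂Q ≤
      ∫ x, (pathReward γ h y (hit A 1 y x) x + c * hit A 1 y x) ∂Q :=
    integral_mono hρi hbonus fun x => le_add_of_nonneg_right (by positivity)
  linarith

end LadderModel

/-! ### Integrability through positive and negative parts -/

lemma integrable_of_lintegral_parts_ne_top {α : Type*} [MeasurableSpace α] {μ : Measure α}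
    {f : α → ℝ} (hf : AEStronglyMeasurable f μ) (h1 : ∫⁻ a, ENNReal.ofReal (f a) ∂μ ≠ ⊤)
    (h2 : ∫⁻ a, ENNReal.ofReal (-f a) ∂μ ≠ ⊤) : Integrable f μ := by
  refine ⟨hf, ?_⟩
  have : ∀ a, ‖f a‖ₑ = ENNReal.ofReal (f a) + ENNReal.ofReal (-f a) := fun a => by
    rw [Real.enorm_eq_ofReal_abs]
    rcases le_total 0 (f a) with h | h
    · rw [abs_of_nonneg h, ENNReal.ofReal_of_nonpos (neg_nonpos.2 h), add_zero]
    · rw [abs_of_nonpos h, ENNReal.ofReal_of_nonpos h, zero_add]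
  rw [HasFiniteIntegral, lintegral_congr this,
    lintegral_add_left' hf.aemeasurable.ennreal_ofReal]
  exact ENNReal.add_lt_top.2 ⟨h1.lt_top, h2.lt_top⟩

lemma lintegral_ofReal_ne_top_of_le {α : Type*} [MeasurableSpace α] {μ : Measure α}
    {f g : α → ℝ} (hg : Integrable g μ) (hfg : ∀ᵐ a ∂μ, f a ≤ g a) :
    ∫⁻ a, ENNReal.ofReal (f a) ∂μ ≠ ⊤ := by
  refine ne_top_of_le_ne_top hg.2.ne (lintegral_mono_ae ?_)
  filter_upwards [hfg] with a ha
  rw [Real.enorm_eq_ofReal_abs]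
  exact ENNReal.ofReal_le_ofReal (ha.trans (le_abs_self _))

lemma lintegral_neg_part_le {α : Type*} [MeasurableSpace α] {μ : Measure α} {f : α → ℝ}
    (hf : Integrable f μ) (h0 : 0 ≤ ∫ a, f a ∂μ) :
    ∫⁻ a, ENNReal.ofReal (-f a) ∂μ ≤ ∫⁻ a, ENNReal.ofReal (f a) ∂μ := by
  rw [integral_eq_lintegral_pos_part_sub_lintegral_neg_part hf, sub_nonneg] at h0
  refine (ENNReal.toReal_le_toReal ?_ ?_).1 h0
  · exact lintegral_ofReal_ne_top_of_le hf.neg (ae_of_all _ fun _ => le_rfl)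
  · exact lintegral_ofReal_ne_top_of_le hf (ae_of_all _ fun _ => le_rfl)

lemma eq_top_or_eq_natCast (s : WithTop ℕ) : s = ⊤ ∨ ∃ k : ℕ, s = (k : WithTop ℕ) := by
  cases s with
  | top => exact Or.inl rfl
  | coe k => exact Or.inr ⟨k, rfl⟩

lemma untopD_natCast (k : ℕ) : (k : WithTop ℕ).untopD 0 = k := rfl

lemma hit_add {A : Set ℝ} {z : ℝ} {x : ℕ → ℝ} {k j : ℕ} (hx : Hits A (k + j) z x) :
    hit A (k + j) z x = k + hit A j (z + psum x k) (shift k x) := by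
  have hx' : Hits A j (z + psum x k) (shift k x) := by
    obtain ⟨m, hm, hmA⟩ := hx
    refine ⟨m - k, by omega, ?_⟩
    rwa [add_assoc, ← psum_add, Nat.add_sub_cancel' (by omega)]
  refine hit_eq (by have := hx'.le; omega) ?_ fun i hi hik => ?_
  · rw [psum_add, ← add_assoc]
    exact hx'.mem
  · have := notMem_of_lt_hit (A := A) (z := z + psum x k) (x := shift k x)
      (n := j) (k := i - k) (by omega) (by omega)
    rwa [add_assoc, ← psum_add, Nat.add_sub_cancel' (by omega)] at this

/-! ### Comparison with an arbitrary stopping time -/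

section RandomWalk

variable {Ω : Type*} [MeasurableSpace Ω] {P : Measure Ω} [IsProbabilityMeasure P]
  {X : ℕ → Ω → ℝ}

/-- A function of the position at `T` and the increments after `T` whose conditional mean is
non-negative is integrable as soon as its positive part is. -/
theorem integrable_after_of_nonneg (hX : ∀ i, Measurable (X i))
    (hindep : iIndepFun X P) (hident : ∀ i, IdentDistrib (X i) (X 0) P P) (y : ℝ) {E : Set Ω}
    {T : Ω → ℕ} (hE : ∀ n, MeasurableSet[past X n] (E ∩ {ω | T ω = n}))
    {Φ : ℝ × (ℕ → ℝ) → ℝ} (hΦ : Measurable Φ)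
    (hint : ∀ z, Integrable (fun x => Φ (z, x)) (P.map (seq X)))
    (h0 : ∀ z, 0 ≤ ∫ x, Φ (z, x) ∂(P.map (seq X)))
    (hpos : ∫⁻ ω in E, ENNReal.ofReal
      (Φ (y + psum (seq X ω) (T ω), shift (T ω) (seq X ω))) ∂P ≠ ⊤) :
    IntegrableOn (fun ω => Φ (y + psum (seq X ω) (T ω), shift (T ω) (seq X ω))) E P := by
  have hm := (map_restrict_eq_prod hX hindep hident y hE).1
  refine integrable_of_lintegral_parts_ne_top (hΦ.comp_aemeasurable hm).aestronglyMeasurable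
    hpos (ne_top_of_le_ne_top hpos ?_)
  rw [lintegral_after hX hindep hident y hE (Φ := fun p => ENNReal.ofReal (-Φ p))
      hΦ.neg.ennreal_ofReal,
    lintegral_after hX hindep hident y hE (Φ := fun p => ENNReal.ofReal (Φ p)) hΦ.ennreal_ofReal]
  exact lintegral_mono fun ω => lintegral_neg_part_le (hint _) (h0 _)

namespace LadderModel

variable {γ h : ℝ → ℝ} {A : Set ℝ} {a : ℝ}

lemma ae_forall_hits {Q : Measure (ℕ → ℝ)} [IsProbabilityMeasure Q] (M : LadderModel Q γ h)
    (hb : Ioi a ⊆ A) (y : ℝ) : ∀ᵐ x ∂Q, ∀ n, Hits A n y x := by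
  have : ∀ᵐ x ∂Q, ∀ k : ℕ, Hits (Ioi (k : ℝ)) 0 y x :=
    ae_all_iff.2 fun k => M.ae_hits (isUpperSet_Ioi _) subset_rfl y
  filter_upwards [this] with x hx n
  -- The level `k` exceeds `a` and the first `n` positions, so a visit above `k` is a visit to `A`
  -- at a time at least `n`.
  obtain ⟨k, hk⟩ := exists_nat_gt (|a| + ∑ j ∈ Finset.range n, |y + psum x j|)
  obtain ⟨m, -, hm⟩ := hx k
  have hm' : (k : ℝ) < y + psum x m := hm
  have hs : 0 ≤ ∑ j ∈ Finset.range n, |y + psum x j| := Finset.sum_nonneg fun _ _ => abs_nonneg _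
  refine ⟨m, ?_, hb (show a < _ by linarith [le_abs_self a])⟩
  by_contra! hmn
  have := Finset.single_le_sum (f := fun j => |y + psum x j|) (fun _ _ => abs_nonneg _)
    (Finset.mem_range.2 hmn)
  linarith [le_abs_self (y + psum x m), abs_nonneg a]

/-- The two visits differ only when the walk starts in `A`, where the comparison is the return
inequality. -/
lemma integral_reward_step_nonpos {Q : Measure (ℕ → ℝ)} [IsProbabilityMeasure Q]
    (M : LadderModel Q γ h) (hA : IsUpperSet A) (hb : Ioi a ⊆ A)
    (hret : ∀ z ∈ A, ∫ x, pathReward γ h z (hit A 1 z x) x ∂Q ≤ γ z) (ha : A ⊆ Ici a) (z : ℝ) :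
    ∫ x, (pathReward γ h z (hit A 1 z x) x - pathReward γ h z (hit A 0 z x) x) ∂Q ≤ 0 := by
  by_cases hz : z ∈ A
  · rw [integral_sub (M.integrable_reward_return hA ha hz) (M.integrable_reward_hit hA hb z)]
    simpa [hit_zero_of_mem hz] using hret z hz
  · refine (integral_eq_zero_of_ae ?_).le
    filter_upwards [M.ae_hits hA hb z] with x hx
    simp [hit_succ_of_notMem hz hx]

/-- Optimality against almost surely finite stopping times with integrable reward. After `τ` is
postponed to a visit to `A`, the mean advantage over the first visit from `n` on, restricted to `τ ≥
n`, is non-decreasing in `n` and bounded by a null sequence, so it is non-positive at `n = 0`. -/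
theorem integral_reward_le (hX : ∀ i, Measurable (X i))
    (hindep : iIndepFun X P) (hident : ∀ i, IdentDistrib (X i) (X 0) P P)
    (M : LadderModel (P.map (seq X)) γ h) (hA : IsUpperSet A) (hb : Ioi a ⊆ A) (ha : A ⊆ Ici a)
    (hconc : ConcaveOn ℝ (Ici a) γ)
    (hwait : ∀ z, γ z ≤ ∫ x, pathReward γ h z (hit A 0 z x) x ∂(P.map (seq X)))
    (hret : ∀ z ∈ A, ∫ x, pathReward γ h z (hit A 1 z x) x ∂(P.map (seq X)) ≤ γ z)
    (y : ℝ) {τ : Ω → WithTop ℕ} (hτ : ∀ n : ℕ, MeasurableSet[past X n] {ω | τ ω = n})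
    (hfin : ∀ᵐ ω ∂P, τ ω ≠ ⊤)
    (hint : Integrable (fun ω => pathReward γ h y ((τ ω).untopD 0) (seq X ω)) P) :
    ∫ ω, pathReward γ h y ((τ ω).untopD 0) (seq X ω) ∂P ≤
      ∫ x, pathReward γ h y (hit A 0 y x) x ∂(P.map (seq X)) := by
  have hAm : MeasurableSet A := hA.ordConnected.measurableSet
  have hsm := measurable_seq hX
  have := Measure.isProbabilityMeasure_map (μ := P) hsm.aemeasurable
  have hγ := M.mono_payoff.measurable
  have hh := M.mono_cost.measurable
  set t : Ω → ℕ := fun ω => (τ ω).untopD 0 with ht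
  have htn : ∀ n : ℕ, {ω | τ ω ≠ ⊤} ∩ {ω | t ω = n} = {ω | τ ω = n} := fun n => by
    ext ω
    rcases eq_top_or_eq_natCast (τ ω) with hω | ⟨k, hω⟩
    · simp [hω]
    · simp [hω, ht, untopD_natCast]
  have hEt : ∀ n : ℕ, MeasurableSet[past X n] ({ω | τ ω ≠ ⊤} ∩ {ω | t ω = n}) := fun n => by
    rw [htn]; exact hτ n
  have hhits : ∀ᵐ ω ∂P, ∀ n, Hits A n y (seq X ω) :=
    ae_of_ae_map hsm.aemeasurable (M.ae_forall_hits hb y)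
  have hGfin : ∀ᵐ ω ∂P, supGain γ h y (seq X ω) ≠ ⊤ :=
    ae_of_ae_map hsm.aemeasurable (M.ae_supGain_ne_top y)
  have hGm := measurable_supGain hγ hh y
  have hGi : Integrable (fun ω => γ y + (supGain γ h y (seq X ω)).toReal) P := by
    refine (integrable_const (γ y)).add ?_
    refine integrable_toReal_of_lintegral_ne_top (hGm.comp hsm).aemeasurable ?_
    rw [← lintegral_map hGm hsm]
    exact M.supGain_ne_top y
  -- the reward at the first visit to `A` from time `n` on
  set R : ℕ → Ω → ℝ := fun n ω => pathReward γ h y (hit A n y (seq X ω)) (seq X ω) with hR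
  have hRm : ∀ n, Measurable (R n) := fun n =>
    (measurable_pathReward_at hγ hh (measurable_hit hAm n)).comp (measurable_const.prodMk hsm)
  have hRle : ∀ᵐ ω ∂P, ∀ n, R n ω ≤ γ y + (supGain γ h y (seq X ω)).toReal := by
    filter_upwards [hGfin] with ω hω n
    linarith [pathReward_sub_le hω (hit A n y (seq X ω))]
  set R' : Ω → ℝ := fun ω => R (t ω) ω with hR'
  -- waiting for a visit to `A` improves the reward
  have step1 : Integrable R' P ∧
      ∫ ω, pathReward γ h y (t ω) (seq X ω) ∂P ≤ ∫ ω, R' ω ∂P := by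
    set Φ : ℝ × (ℕ → ℝ) → ℝ := fun p => pathReward γ h p.1 (hit A 0 p.1 p.2) p.2 - γ p.1 with hΦ
    have hΦm : Measurable Φ := (measurable_pathReward_at hγ hh (measurable_hit hAm 0)).sub
      (hγ.comp measurable_fst)
    have hΦi : ∀ z, Integrable (fun x => Φ (z, x)) (P.map (seq X)) := fun z =>
      (M.integrable_reward_hit hA hb z).sub (integrable_const (γ z))
    have hΦ0 : ∀ z, 0 ≤ ∫ x, Φ (z, x) ∂(P.map (seq X)) := fun z => by
      simp only [hΦ]
      rw [integral_sub (M.integrable_reward_hit hA hb z) (integrable_const _)]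
      simpa using hwait z
    have hsplit : ∀ᵐ ω ∂P, Φ (y + psum (seq X ω) (t ω), shift (t ω) (seq X ω)) =
        R' ω - pathReward γ h y (t ω) (seq X ω) := by
      filter_upwards [hhits] with ω hω
      have := hit_add (k := t ω) (j := 0) (hω (t ω + 0))
      simp only [add_zero] at this
      simp only [hΦ, hR', hR]
      rw [this, pathReward_add]
      ring
    have hres : P.restrict {ω | τ ω ≠ ⊤} = P := Measure.restrict_eq_self_of_ae_mem hfin
    -- The envelope given by the supremal gain controls the positive part only; the negative part is
    -- controlled because the conditional mean is non-negative.
    have hon := integrable_after_of_nonneg hX hindep hident y hEt hΦm hΦi hΦ0 (by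
      rw [hres]
      refine lintegral_ofReal_ne_top_of_le (hGi.sub hint) ?_
      filter_upwards [hsplit, hRle] with ω h1 h2
      rw [h1]
      exact sub_le_sub_right (h2 _) _)
    have hval := (integral_after hX hindep hident y hEt hΦm hon).2
    rw [IntegrableOn, hres] at hon
    rw [hres] at hval
    have hon' : Integrable (fun ω => R' ω - pathReward γ h y (t ω) (seq X ω)) P :=
      hon.congr hsplit
    have hR'i : Integrable R' P := by
      refine (hon'.add hint).congr (ae_of_all _ fun ω => ?_)
      simp [ht]
    refine ⟨hR'i, ?_⟩
    rw [integral_congr_ae hsplit, integral_sub hR'i hint] at hval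
    have : 0 ≤ ∫ ω, ∫ x, Φ (y + psum (seq X ω) (t ω), x) ∂(P.map (seq X)) ∂P :=
      integral_nonneg fun ω => hΦ0 _
    linarith
  obtain ⟨hR'i, hle⟩ := step1
  refine hle.trans ?_
  -- the events that `τ` has not occurred before `n`
  set D : ℕ → Set Ω := fun n => {ω | (n : WithTop ℕ) ≤ τ ω} with hD
  -- The event `τ ≥ n + 1` is known at time `n`, which allows conditioning there in the monotonicity
  -- step.
  have hDsucc : ∀ n, MeasurableSet[past X n] (D (n + 1)) := fun n => by
    have : D (n + 1) = (⋃ m, ⋃ (_ : m ≤ n), {ω | τ ω = (m : WithTop ℕ)})ᶜ := by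
      ext ω
      simp only [hD, mem_ofPred_eq, mem_compl_iff, mem_iUnion, exists_prop, not_exists, not_and]
      rcases eq_top_or_eq_natCast (τ ω) with hω | ⟨k, hω⟩
      · simp [hω]
      · rw [hω]
        simp only [Nat.cast_le, Nat.cast_inj]
        constructor
        · rintro hk m hm rfl
          omega
        · intro hk
          by_contra! hcon
          exact hk k (by omega) rfl
    rw [this]
    exact @MeasurableSet.compl _ _ (past X n) (@MeasurableSet.iUnion _ _ (past X n) _ _ fun m =>
      @MeasurableSet.iUnion _ _ (past X n) _ _ fun hm => past_mono hm _ (hτ m))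
  have hDn : ∀ n, MeasurableSet[past X n] (D n) := fun n => by
    cases n with
    | zero =>
      have : D 0 = univ := by ext; simp [hD]
      rw [this]
      exact @MeasurableSet.univ _ (past X 0)
    | succ n => exact past_mono (Nat.le_succ n) _ (hDsucc n)
  have hDm : ∀ n, MeasurableSet (D n) := fun n => past_le hX n _ (hDn n)
  have hDt : ∀ᵐ ω ∂P, ∀ n, ω ∈ D n → n ≤ t ω := by
    filter_upwards [hfin] with ω hω n hn
    rcases eq_top_or_eq_natCast (τ ω) with hω' | ⟨k, hω'⟩
    · exact absurd hω' hω
    · simp only [hD, mem_ofPred_eq, hω', Nat.cast_le] at hn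
      simpa [ht, hω', untopD_natCast] using hn
  set S : ℝ≥0∞ := ∫⁻ x, supGain γ h a x ∂(P.map (seq X)) with hS
  have hSfin : S ≠ ⊤ := M.supGain_ne_top a
  -- The first visit from `n` on is at a level at least `a`, so by concavity every later gain is at
  -- most the supremal gain from `a` along the shifted increments, which are independent of `D n`.
  have hupper : ∀ n, ∫⁻ ω in D n, ENNReal.ofReal (R' ω - R n ω) ∂P ≤ S * P (D n) := by
    intro n
    have hEn := measurableSet_past_hit (X := X) hAm (hDn n) y
    have h1 := lintegral_after hX hindep hident y hEn
      (Φ := fun p => supGain γ h a p.2) ((measurable_supGain hγ hh a).comp measurable_snd)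
    have hres : P.restrict (D n ∩ {ω | Hits A n y (seq X ω)}) = P.restrict (D n) := by
      refine Measure.restrict_congr_set ?_
      filter_upwards [hhits] with ω hω
      exact propext ⟨fun hx => hx.1, fun hx => ⟨hx, hω n⟩⟩
    rw [hres] at h1
    calc ∫⁻ ω in D n, ENNReal.ofReal (R' ω - R n ω) ∂P
        ≤ ∫⁻ ω in D n, supGain γ h a (shift (hit A n y (seq X ω)) (seq X ω)) ∂P := by
          refine lintegral_mono_ae ?_
          filter_upwards [ae_restrict_mem (hDm n), ae_restrict_of_ae hhits, ae_restrict_of_ae hDt]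
            with ω hω hω' hωt
          have hnt := hωt n hω
          have hle' : hit A n y (seq X ω) ≤ hit A (t ω) y (seq X ω) :=
            hit_le (hnt.trans (hω' (t ω)).le) (hω' (t ω)).mem
          refine le_trans ?_ (supGain_le M.mono_payoff M.mono_cost M.cost_nonneg hconc
            (ha (hω' n).mem) _)
          obtain ⟨m, hm⟩ := Nat.exists_eq_add_of_le hle'
          have : R' ω - R n ω = pathReward γ h (y + psum (seq X ω) (hit A n y (seq X ω))) m
              (shift (hit A n y (seq X ω)) (seq X ω)) -
              γ (y + psum (seq X ω) (hit A n y (seq X ω))) := by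
            simp only [hR', hR]
            rw [hm, pathReward_add]
            ring
          rw [this]
          exact le_iSup (fun m => ENNReal.ofReal (pathReward γ h
            (y + psum (seq X ω) (hit A n y (seq X ω))) m
              (shift (hit A n y (seq X ω)) (seq X ω)) -
              γ (y + psum (seq X ω) (hit A n y (seq X ω))))) m
      _ = S * P (D n) := by
          rw [h1]
          simp [hS]
  have hdiff : ∀ n, IntegrableOn (fun ω => R' ω - R n ω) (D n) P := fun n => by
    refine integrable_of_lintegral_parts_ne_top
      (hR'i.aestronglyMeasurable.sub (hRm n).aestronglyMeasurable).restrict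
      (ne_top_of_le_ne_top (ENNReal.mul_ne_top hSfin (measure_ne_top _ _)) (hupper n))
      (lintegral_ofReal_ne_top_of_le (hGi.sub hR'i).integrableOn ?_)
    filter_upwards [ae_restrict_of_ae hRle] with ω hω
    have := hω n
    simp only [Pi.sub_apply]
    linarith
  have hmono : ∀ n, ∫ ω in D n, (R' ω - R n ω) ∂P ≤
      ∫ ω in D (n + 1), (R' ω - R (n + 1) ω) ∂P := by
    intro n
    have hsub : D (n + 1) ⊆ D n := fun ω hω =>
      le_trans (Nat.cast_le.2 (Nat.le_succ n)) (show ((n + 1 : ℕ) : WithTop ℕ) ≤ τ ω from hω)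
    have hE : ∀ m, MeasurableSet[past X m] (D (n + 1) ∩ {_ω : Ω | n = m}) := fun m => by
      by_cases hnm : n = m
      · subst hnm
        simp [hDsucc n]
      · simp [hnm]
    set Φ : ℝ × (ℕ → ℝ) → ℝ := fun p => pathReward γ h p.1 (hit A 1 p.1 p.2) p.2 -
      pathReward γ h p.1 (hit A 0 p.1 p.2) p.2 with hΦ
    have hΦm : Measurable Φ := (measurable_pathReward_at hγ hh (measurable_hit hAm 1)).sub
      (measurable_pathReward_at hγ hh (measurable_hit hAm 0))
    have hsplit : ∀ᵐ ω ∂P, Φ (y + psum (seq X ω) n, shift n (seq X ω)) =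
        R (n + 1) ω - R n ω := by
      filter_upwards [hhits] with ω hω
      have h1 := hit_add (k := n) (j := 1) (hω (n + 1))
      have h0 := hit_add (k := n) (j := 0) (hω (n + 0))
      simp only [add_zero] at h0
      simp only [hΦ, hR]
      rw [h1, h0, pathReward_add, pathReward_add]
      ring
    have hi0 : IntegrableOn (fun ω => R' ω - R n ω) (D (n + 1)) P := (hdiff n).mono_set hsub
    have hi1 := hdiff (n + 1)
    have hstep : IntegrableOn (fun ω => R (n + 1) ω - R n ω) (D (n + 1)) P := by
      refine (hi0.sub hi1).congr (ae_of_all _ fun ω => ?_)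
      simp
    have h2 := (integral_after hX hindep hident y hE hΦm
      (hstep.congr (ae_restrict_of_ae (hsplit.mono fun ω hω => hω.symm)))).2
    rw [integral_congr_ae (ae_restrict_of_ae hsplit)] at h2
    have h3 : ∫ ω in D (n + 1), (R (n + 1) ω - R n ω) ∂P ≤ 0 := by
      rw [h2]
      exact integral_nonpos fun ω => M.integral_reward_step_nonpos hA hb hret ha _
    -- On `D n \ D (n + 1)` one has `τ = n`, so the two rewards coincide.
    have h4 : ∫ ω in D n, (R' ω - R n ω) ∂P = ∫ ω in D (n + 1), (R' ω - R n ω) ∂P := by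
      refine setIntegral_eq_of_subset_of_forall_sdiff_eq_zero (hDm n) hsub fun ω hω => ?_
      have hτn : τ ω = n := by
        have h1 : (n : WithTop ℕ) ≤ τ ω := hω.1
        have h2 : ¬ ((n + 1 : ℕ) : WithTop ℕ) ≤ τ ω := hω.2
        rcases eq_top_or_eq_natCast (τ ω) with hω' | ⟨k, hω'⟩
        · simp [hω'] at h2
        · rw [hω', Nat.cast_le] at h1 h2
          rw [hω', show k = n by omega]
      simp [hR', ht, hτn, untopD_natCast]
    have h5 : ∫ ω in D (n + 1), (R' ω - R n ω) ∂P =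
        ∫ ω in D (n + 1), (R' ω - R (n + 1) ω) ∂P +
          ∫ ω in D (n + 1), (R (n + 1) ω - R n ω) ∂P := by
      rw [← integral_add hi1 hstep]
      exact integral_congr_ae (ae_of_all _ fun ω => by ring)
    linarith
  have hlim : Tendsto (fun n => (S * P (D n)).toReal) atTop (𝓝 0) := by
    have hD0 : P (⋂ n, D n) = 0 := by
      refine measure_mono_null (fun ω hω => ?_) hfin
      simp only [hD, mem_iInter, mem_ofPred_eq] at hω
      simp only [mem_compl_iff, mem_ofPred_eq, not_not]
      rcases eq_top_or_eq_natCast (τ ω) with hω' | ⟨k, hω'⟩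
      · exact hω'
      · have := hω (k + 1)
        rw [hω', Nat.cast_le] at this
        omega
    have h1 : Tendsto (fun n => P (D n)) atTop (𝓝 0) := by
      rw [← hD0]
      refine tendsto_measure_iInter_atTop (fun n => (hDm n).nullMeasurableSet)
        (fun m n hmn ω hω => le_trans (Nat.cast_le.2 hmn) (show (n : WithTop ℕ) ≤ τ ω from hω)) ⟨0, measure_ne_top _ _⟩
    have h2 := ENNReal.Tendsto.const_mul (a := S) h1 (Or.inr hSfin)
    rw [mul_zero] at h2
    exact (ENNReal.tendsto_toReal ENNReal.zero_ne_top).comp h2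
  have hI : ∀ n, ∫ ω in D 0, (R' ω - R 0 ω) ∂P ≤ (S * P (D n)).toReal := by
    intro n
    refine (monotone_nat_of_le_succ hmono (Nat.zero_le n)).trans ?_
    refine (ENNReal.ofReal_le_iff_le_toReal
      (ENNReal.mul_ne_top hSfin (measure_ne_top _ _))).1 ?_
    exact (ofReal_integral_le_lintegral _).trans (hupper n)
  have hI0 : ∫ ω in D 0, (R' ω - R 0 ω) ∂P ≤ 0 := ge_of_tendsto' hlim hI
  have hD0 : D 0 = univ := by ext; simp [hD]
  have hReq : ∫ x, pathReward γ h y (hit A 0 y x) x ∂(P.map (seq X)) = ∫ ω, R 0 ω ∂P :=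
    integral_map hsm.aemeasurable ((measurable_pathReward_at hγ hh (measurable_hit hAm 0)).comp
      (measurable_prodMk_left (x := y))).aestronglyMeasurable
  have hR0 : Integrable (R 0) P := (M.integrable_reward_hit hA hb y).comp_measurable hsm
  rw [hD0, Measure.restrict_univ, integral_sub hR'i hR0] at hI0
  rw [hReq]
  linarith

end LadderModel

end RandomWalk

/-! ### Extended expectations -/

section Expect

variable {Ω : Type*} [MeasurableSpace Ω] {P : Measure Ω}

lemma expect_congr {Z Z' : Ω → EReal} (h : Z =ᵐ[P] Z') : expect P Z = expect P Z' := by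
  unfold expect
  rw [lintegral_congr_ae (h.mono fun ω hω => by rw [hω]),
    lintegral_congr_ae (h.mono fun ω hω => show (-Z ω).toENNReal = (-Z' ω).toENNReal by rw [hω])]

lemma expect_coe {f : Ω → ℝ} (hf : Integrable f P) :
    expect P (fun ω => (f ω : EReal)) = ((∫ ω, f ω ∂P : ℝ) : EReal) := by
  have h1 : ∫⁻ ω, ENNReal.ofReal (f ω) ∂P ≠ ⊤ :=
    lintegral_ofReal_ne_top_of_le hf (ae_of_all _ fun _ => le_rfl)
  have h2 : ∫⁻ ω, ENNReal.ofReal (-f ω) ∂P ≠ ⊤ :=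
    lintegral_ofReal_ne_top_of_le hf.neg (ae_of_all _ fun _ => le_rfl)
  simp only [expect, ← EReal.coe_neg, EReal.real_coe_toENNReal]
  rw [integral_eq_lintegral_pos_part_sub_lintegral_neg_part hf, EReal.coe_sub,
    EReal.coe_ennreal_toReal h1, EReal.coe_ennreal_toReal h2]

/-- No condition on the positive part is needed, because `⊤ - ⊤ = ⊥` in `EReal`. -/
lemma expect_eq_bot {Z : Ω → EReal} (h : ∫⁻ ω, (-Z ω).toENNReal ∂P = ⊤) : expect P Z = ⊥ := by
  rw [expect, h, EReal.coe_ennreal_top, EReal.sub_top]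

end Expect

/-! ### Transfer from the probability space to the law of the increments -/

section Bridge

variable {Ω : Type*} {X : ℕ → Ω → ℝ}

lemma hittingAfter_eq_hit {A : Set ℝ} {y : ℝ} {ω : Ω} (hx : Hits A 0 y (seq X ω)) :
    hittingAfter (startedWalk X y) A 0 ω = (hit A 0 y (seq X ω) : WithTop ℕ) :=
  if_pos hx

lemma hittingAfter_eq_top {A : Set ℝ} {y : ℝ} {ω : Ω} (hx : ¬ Hits A 0 y (seq X ω)) :
    hittingAfter (startedWalk X y) A 0 ω = ⊤ :=
  if_neg hx

lemma ladderTime_eq_hittingAfter : ladderTime X = hittingAfter (startedWalk X 0) (Ioi 0) 0 := by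
  have : walk X = startedWalk X 0 := by
    ext n ω
    simp [startedWalk]
  rw [ladderTime, this]

lemma stoppedValue_ladderTime (u : ℕ → Ω → ℝ) {ω : Ω} (hx : Hits (Ioi 0) 0 0 (seq X ω)) :
    stoppedValue u (ladderTime X) ω = u (ladder (seq X ω)) ω := by
  rw [stoppedValue, ladderTime_eq_hittingAfter, hittingAfter_eq_hit hx]
  rfl

variable [MeasurableSpace Ω] {P : Measure Ω} {γ h : ℝ → ℝ}

lemma meanLadderTime_eq (hX : ∀ i, Measurable (X i)) (hlt : meanLadderTime P X < ⊤) :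
    (∀ᵐ x ∂(P.map (seq X)), Hits (Ioi 0) 0 0 x) ∧
    Integrable (fun x => (ladder x : ℝ)) (P.map (seq X)) ∧
    (meanLadderTime P X).toReal = ∫ x, (ladder x : ℝ) ∂(P.map (seq X)) := by
  classical
  have hsm := measurable_seq hX
  have hHm : MeasurableSet {x | Hits (Ioi 0) 0 0 x} :=
    (measurable_prodMk_left (x := (0 : ℝ))) (measurableSet_hits measurableSet_Ioi 0)
  have hlm : Measurable fun x => (ladder x : ℝ≥0∞) := measurable_from_top.comp measurable_ladder
  -- `g` restores the value `⊤` where `ladder` defaults to `0`; a finite mean then forces the ladder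
  -- time to be finite almost surely.
  set g : (ℕ → ℝ) → ℝ≥0∞ := fun x => if Hits (Ioi 0) 0 0 x then (ladder x : ℝ≥0∞) else ⊤ with hg
  have hgm : Measurable g := Measurable.ite hHm hlm measurable_const
  have hgeq : meanLadderTime P X = ∫⁻ x, g x ∂(P.map (seq X)) := by
    rw [lintegral_map hgm hsm, meanLadderTime]
    refine lintegral_congr fun ω => ?_
    rw [ladderTime_eq_hittingAfter]
    by_cases hx : Hits (Ioi 0) 0 0 (seq X ω)
    · rw [hittingAfter_eq_hit hx]
      simp only [hg, if_pos hx]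
      exact ENat.toENNReal_coe _
    · rw [hittingAfter_eq_top hx]
      simp only [hg, if_neg hx]
      exact ENat.toENNReal_top
  rw [hgeq] at hlt ⊢
  have hhits : ∀ᵐ x ∂(P.map (seq X)), Hits (Ioi 0) 0 0 x := by
    filter_upwards [ae_lt_top hgm hlt.ne] with x hx
    by_contra hcon
    simp [hg, hcon] at hx
  have hgl : ∫⁻ x, g x ∂(P.map (seq X)) = ∫⁻ x, (ladder x : ℝ≥0∞) ∂(P.map (seq X)) := by
    refine lintegral_congr_ae ?_
    filter_upwards [hhits] with x hx
    simp [hg, hx]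
  rw [hgl] at hlt ⊢
  have hcast : (fun x => (ladder x : ℝ)) = fun x => ((ladder x : ℝ≥0∞)).toReal := by
    ext x; simp
  refine ⟨hhits, ?_, ?_⟩
  · rw [hcast]
    exact integrable_toReal_of_lintegral_ne_top hlm.aemeasurable hlt.ne
  · rw [hcast, integral_toReal hlm.aemeasurable (ae_of_all _ fun x => by simp)]

variable [IsProbabilityMeasure P]

/-- The supremum is at least the reward `γ y` at time `0`, so its negative part is bounded, and an
expectation below `⊤` then forces a finite positive part. -/
lemma lintegral_supGain_ne_top (hX : ∀ i, Measurable (X i)) (hγ : Measurable γ) (hh : Measurable h)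
    {y : ℝ} (hsup : expect P (fun ω => ⨆ n : ℕ, (reward X γ h y n ω : EReal)) < ⊤) :
    ∫⁻ x, supGain γ h y x ∂(P.map (seq X)) ≠ ⊤ := by
  set Z : Ω → EReal := fun ω => ⨆ n : ℕ, (reward X γ h y n ω : EReal) with hZ
  have hneg : ∫⁻ ω, (-Z ω).toENNReal ∂P ≠ ⊤ := by
    refine ne_top_of_le_ne_top (ENNReal.ofReal_ne_top (r := -γ y)) ?_
    calc ∫⁻ ω, (-Z ω).toENNReal ∂P ≤ ∫⁻ _, ENNReal.ofReal (-γ y) ∂P := by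
          refine lintegral_mono fun ω => ?_
          rw [← EReal.real_coe_toENNReal, EReal.coe_neg]
          refine EReal.toENNReal_le_toENNReal (EReal.neg_le_neg_iff.2 ?_)
          refine le_trans (le_of_eq ?_) (le_iSup (fun n => (reward X γ h y n ω : EReal)) 0)
          exact congrArg _ (pathReward_zero γ h y (seq X ω)).symm
      _ = ENNReal.ofReal (-γ y) := by simp
  have hpos : ∫⁻ ω, (Z ω).toENNReal ∂P ≠ ⊤ := by
    intro hcon
    rw [expect, hcon, EReal.coe_ennreal_top,
      EReal.top_sub (by rwa [ne_eq, EReal.coe_ennreal_eq_top_iff])] at hsup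
    exact lt_irrefl _ hsup
  rw [lintegral_map (measurable_supGain hγ hh y) (measurable_seq hX)]
  refine ne_top_of_le_ne_top (ENNReal.add_ne_top.2 ⟨hpos, ENNReal.ofReal_ne_top (r := -γ y)⟩) ?_
  calc ∫⁻ ω, supGain γ h y (seq X ω) ∂P
      ≤ ∫⁻ ω, ((Z ω).toENNReal + ENNReal.ofReal (-γ y)) ∂P := by
        refine lintegral_mono fun ω => iSup_le fun n => ?_
        rw [sub_eq_add_neg]
        refine ENNReal.ofReal_add_le.trans (add_le_add ?_ le_rfl)
        rw [← EReal.real_coe_toENNReal]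
        exact EReal.toENNReal_le_toENNReal (le_iSup (fun n => (reward X γ h y n ω : EReal)) n)
    _ = ∫⁻ ω, (Z ω).toENNReal ∂P + ENNReal.ofReal (-γ y) := by
        rw [lintegral_add_right _ measurable_const]
        simp

lemma ladderModel (hX : ∀ i, Measurable (X i)) (hindep : iIndepFun X P)
    (hident : ∀ i, IdentDistrib (X i) (X 0) P P) (hpos : 0 < P {ω | 0 < X 0 ω})
    (hγ : Monotone γ) (hh : Monotone h) (hh0 : ∀ x, 0 ≤ h x)
    (hassum : StandingAssumption P X γ h) (hf : GainRateWellDefined P X γ h) :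
    LadderModel (P.map (seq X)) γ h := by
  have hsm := measurable_seq hX
  have := Measure.isProbabilityMeasure_map (μ := P) hsm.aemeasurable
  obtain ⟨hhits, hint, -⟩ := meanLadderTime_eq hX hf.meanLadderTime_lt_top
  have hhits' : ∀ᵐ ω ∂P, Hits (Ioi 0) 0 0 (seq X ω) := ae_of_ae_map hsm.aemeasurable hhits
  have heval : ∀ i, (P.map (seq X)).map (fun x => x i) = P.map (X i) := fun i =>
    Measure.map_map (measurable_pi_apply i) hsm
  refine ⟨⟨?_, fun i => ?_⟩, ?_, hhits, hγ, hh, hh0, hint, fun z => ?_, fun z => ?_, fun z =>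
    lintegral_supGain_ne_top hX hγ.measurable hh.measurable (hassum.expect_sup_lt_top z)⟩
  · rw [iIndepFun_iff_map_fun_eq_infinitePi_map fun i => measurable_pi_apply i]
    simp_rw [heval]
    exact Measure.map_id.trans (hindep.map_fun_eq_infinitePi_map hX)
  · exact ⟨(measurable_pi_apply i).aemeasurable, (measurable_pi_apply 0).aemeasurable, by
      rw [heval, heval, (hident i).map_eq]⟩
  · rw [Measure.map_apply hsm (measurableSet_lt measurable_const (measurable_pi_apply 0))]
    exact hpos
  · have hm : Measurable fun x => γ (z + psum x (ladder x)) :=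
      hγ.measurable.comp (measurable_const.add (measurable_psum_at measurable_id measurable_ladder))
    rw [integrable_map_measure hm.aestronglyMeasurable hsm.aemeasurable]
    refine (hf.integrable_payoff z).congr ?_
    filter_upwards [hhits'] with ω hω
    rw [stoppedValue_ladderTime _ hω]
    rfl
  · have hl : Measurable fun p : ℝ × (ℕ → ℝ) => ladder p.2 := measurable_ladder.comp measurable_snd
    have hm := (measurable_pathCost_at hh.measurable hl).comp (measurable_prodMk_left (x := z))
    simp only [Function.comp_def] at hm
    rw [integrable_map_measure hm.aestronglyMeasurable hsm.aemeasurable]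
    refine (hf.integrable_cost z).congr ?_
    filter_upwards [hhits'] with ω hω
    rw [stoppedValue_ladderTime _ hω]
    rfl

omit [IsProbabilityMeasure P] in
lemma ladderReward_eq (hX : ∀ i, Measurable (X i)) (M : LadderModel (P.map (seq X)) γ h) (z : ℝ) :
    ladderReward P X γ h z = ∫ x, pathReward γ h z (ladder x) x ∂(P.map (seq X)) := by
  have hsm := measurable_seq hX
  have hhits : ∀ᵐ ω ∂P, Hits (Ioi 0) 0 0 (seq X ω) := ae_of_ae_map hsm.aemeasurable M.hits
  rw [integral_map hsm.aemeasurable (M.integrable_reward_ladder z).aestronglyMeasurable]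
  refine integral_congr_ae ?_
  filter_upwards [hhits] with ω hω
  rw [stoppedValue_ladderTime _ hω]
  rfl

lemma mem_noGainSet_iff (hf : GainRateWellDefined P X γ h) (z : ℝ) :
    z ∈ noGainSet P X γ h ↔ ladderReward P X γ h z ≤ γ z := by
  have hl : ladderReward P X γ h z =
      ∫ ω, γ (stoppedValue (startedWalk X z) (ladderTime X) ω) ∂P -
        ∫ ω, stoppedValue (runningCost X h z) (ladderTime X) ω ∂P :=
    integral_sub (hf.integrable_payoff z) (hf.integrable_cost z)
  simp only [noGainSet, mem_ofPred_eq]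
  rw [integral_sub (integrable_const _) (hf.integrable_payoff z), hl]
  simp only [integral_const, probReal_univ, smul_eq_mul, one_mul, ge_iff_le]
  constructor <;> intro <;> linarith

end Bridge

/-! ### Optimality of entering the stopping set -/

section Optimality

variable {Ω : Type*} [MeasurableSpace Ω] {P : Measure Ω} [IsProbabilityMeasure P]
  {X : ℕ → Ω → ℝ} {γ h : ℝ → ℝ} {A : Set ℝ} {a : ℝ}

/-- At the ladder time the path has risen, so `pathReward_sub_anti` applies path by path. -/
lemma LadderModel.ladder_gain_anti {Q : Measure (ℕ → ℝ)} [IsProbabilityMeasure Q]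
    (M : LadderModel Q γ h) (hconc : ConcaveOn ℝ (Ici a) γ) {z z' : ℝ} (hz : a ≤ z)
    (hzz' : z ≤ z') :
    ∫ x, pathReward γ h z' (ladder x) x ∂Q - γ z' ≤ ∫ x, pathReward γ h z (ladder x) x ∂Q - γ z := by
  have hsub : ∀ z, ∫ x, pathReward γ h z (ladder x) x ∂Q - γ z =
      ∫ x, (pathReward γ h z (ladder x) x - γ z) ∂Q := fun z => by
    rw [integral_sub (M.integrable_reward_ladder z) (integrable_const _)]
    simp
  rw [hsub, hsub]
  refine integral_mono_ae ((M.integrable_reward_ladder z').sub (integrable_const _))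
    ((M.integrable_reward_ladder z).sub (integrable_const _)) ?_
  filter_upwards [M.hits] with x hx
  exact pathReward_sub_anti M.mono_cost (hconc.subset (Ici_subset_Ici.2 hz) (convex_Ici z)) hzz'
    (ladder_spec hx).1

lemma LadderModel.integral_ladder_pos {Q : Measure (ℕ → ℝ)} [IsProbabilityMeasure Q]
    (M : LadderModel Q γ h) : 0 < ∫ x, (ladder x : ℝ) ∂Q := by
  refine lt_of_lt_of_le one_pos ?_
  calc (1 : ℝ) = ∫ _, 1 ∂Q := by simp
    _ ≤ ∫ x, (ladder x : ℝ) ∂Q := by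
      refine integral_mono_ae (integrable_const _) M.integrable_ladder ?_
      filter_upwards [M.hits] with x hx
      exact_mod_cast ladder_pos hx

lemma walkFiltration_le_past (hX : ∀ i, Measurable (X i)) (y : ℝ) (n : ℕ) :
    walkFiltration hX y n ≤ past X n :=
  iSup₂_le fun _ hj => Measurable.comap_le
    ((@measurable_const _ _ _ (past X n) y).add (measurable_past_psum hj))

/-- Entering `A` is optimal, if waiting for the next ladder time is favourable outside of `A` and
unfavourable in `A`. -/
theorem isOptimal_hittingAfter (hX : ∀ i, Measurable (X i)) (hindep : iIndepFun X P)
    (hident : ∀ i, IdentDistrib (X i) (X 0) P P) (M : LadderModel (P.map (seq X)) γ h)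
    (hA : IsUpperSet A) (hb : Ioi a ⊆ A) (ha : A ⊆ Ici a) (hconc : ConcaveOn ℝ (Ici a) γ)
    (hout : ∀ z ∉ A, γ z ≤ ∫ x, pathReward γ h z (ladder x) x ∂(P.map (seq X)))
    (hin : ∀ z ∈ A, ∫ x, pathReward γ h z (ladder x) x ∂(P.map (seq X)) ≤ γ z) (y : ℝ) :
    IsOptimal hX P γ h y (hittingAfter (startedWalk X y) A 0) := by
  have hsm := measurable_seq hX
  have := Measure.isProbabilityMeasure_map (μ := P) hsm.aemeasurable
  have hAm : MeasurableSet A := hA.ordConnected.measurableSet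
  have hγm := M.mono_payoff.measurable
  have hhm := M.mono_cost.measurable
  set e : ℝ := ∫ x, (ladder x : ℝ) ∂(P.map (seq X)) with he
  have hepos : 0 < e := M.integral_ladder_pos
  have hbonus : ∀ c z, ∫ x, (pathReward γ h z (ladder x) x + c * ladder x) ∂(P.map (seq X)) =
      ∫ x, pathReward γ h z (ladder x) x ∂(P.map (seq X)) + c * e := fun c z => by
    rw [integral_add (M.integrable_reward_ladder z) (M.integrable_ladder.const_mul c),
      integral_const_mul]
  have hwait : ∀ z, γ z ≤ ∫ x, pathReward γ h z (hit A 0 z x) x ∂(P.map (seq X)) := fun z => by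
    simpa using M.le_integral_reward_hit hA hb le_rfl (c := 0)
      (fun z hz => by simpa using hout z hz) z
  have hret : ∀ z ∈ A, ∫ x, pathReward γ h z (hit A 1 z x) x ∂(P.map (seq X)) ≤ γ z := by
    intro v hv
    have hgv := hin v hv
    set φ : ℝ → ℝ := fun z => ∫ x, pathReward γ h z (ladder x) x ∂(P.map (seq X)) with hφ
    have hce : (γ v - φ v) / e * e = γ v - φ v := div_mul_cancel₀ _ hepos.ne'
    -- This `c` is `-f v`, the bonus that makes the ladder time exactly neutral at `v`. For lower
    -- levels the ladder gain is at least that at `v` on `Ici a`, by concavity, and already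
    -- non-negative below `a`.
    refine M.integral_reward_return_le hA ha hv (c := (γ v - φ v) / e)
      (div_nonneg (sub_nonneg.2 hgv) hepos.le) ?_ fun z hz => ?_
    · rw [hbonus, hce]
      simp [hφ]
    · rw [hbonus, hce]
      by_cases hza : a ≤ z
      · have := M.ladder_gain_anti hconc hza hz
        simp only [hφ] at *
        linarith
      · have := hout z fun hzA => hza (ha hzA)
        simp only [hφ] at *
        linarith
  have hstopping : IsStoppingTime (walkFiltration hX y) (hittingAfter (startedWalk X y) A 0) := by
    refine Adapted.isStoppingTime_hittingAfter (fun n => ?_) hAm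
    exact (comap_measurable (startedWalk X y n)).mono
      (le_biSup (fun j => MeasurableSpace.comap (startedWalk X y j) inferInstance) (le_refl n)) le_rfl
  set v : ℝ := ∫ x, pathReward γ h y (hit A 0 y x) x ∂(P.map (seq X)) with hv
  have hopt : expect P (fun ω => rewardAt X γ h y (hittingAfter (startedWalk X y) A 0 ω) ω) = v := by
    have hhits : ∀ᵐ ω ∂P, Hits A 0 y (seq X ω) :=
      ae_of_ae_map hsm.aemeasurable (M.ae_hits hA hb y)
    have hint := M.integrable_reward_hit hA hb y
    rw [hv, integral_map hsm.aemeasurable hint.aestronglyMeasurable]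
    refine Eq.trans (expect_congr ?_) (expect_coe (hint.comp_measurable hsm))
    filter_upwards [hhits] with ω hω
    rw [hittingAfter_eq_hit hω]
    rfl
  refine ⟨hstopping, le_antisymm (le_iSup₂_of_le _ hstopping le_rfl) ?_⟩
  rw [hopt]
  refine iSup₂_le fun τ hτ => ?_
  have hτn : ∀ n : ℕ, MeasurableSet[past X n] {ω | τ ω = n} := fun n =>
    walkFiltration_le_past hX y n _ (hτ.measurableSet_eq n)
  have hτn' : ∀ n : ℕ, MeasurableSet {ω | τ ω = n} := fun n => past_le hX n _ (hτn n)
  have hτtop : MeasurableSet {ω | τ ω = ⊤} := by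
    have : {ω | τ ω = ⊤} = (⋃ n : ℕ, {ω | τ ω = n})ᶜ := by
      ext ω
      rcases eq_top_or_eq_natCast (τ ω) with hω | ⟨k, hω⟩ <;> simp [hω]
    rw [this]
    exact (MeasurableSet.iUnion hτn').compl
  -- Never stopping with positive probability makes the expected reward `⊥`, so only almost surely
  -- finite times compete.
  by_cases hfin : ∀ᵐ ω ∂P, τ ω ≠ ⊤
  swap
  · rw [expect_eq_bot]
    · exact bot_le
    refine top_unique ?_
    have hne : P {ω | τ ω = ⊤} ≠ 0 := fun h0 => hfin (by simpa [ae_iff] using h0)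
    calc ⊤ = ∫⁻ _ in {ω | τ ω = ⊤}, ⊤ ∂P := by
          rw [lintegral_const, Measure.restrict_apply_univ, ENNReal.top_mul hne]
      _ ≤ ∫⁻ ω in {ω | τ ω = ⊤}, (-rewardAt X γ h y (τ ω) ω).toENNReal ∂P := by
          refine setLIntegral_mono_ae' hτtop (ae_of_all _ fun ω hω => ?_)
          have hω' : τ ω = none := hω
          rw [hω']
          simp [rewardAt]
      _ ≤ ∫⁻ ω, (-rewardAt X γ h y (τ ω) ω).toENNReal ∂P := setLIntegral_le_lintegral _ _
  set R : Ω → ℝ := fun ω => pathReward γ h y ((τ ω).untopD 0) (seq X ω) with hR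
  have hcoe : (fun ω => rewardAt X γ h y (τ ω) ω) =ᵐ[P] fun ω => (R ω : EReal) := by
    filter_upwards [hfin] with ω hω
    rcases eq_top_or_eq_natCast (τ ω) with hω' | ⟨k, hω'⟩
    · exact absurd hω' hω
    · simp only [hR]
      rw [hω']
      rfl
  rw [expect_congr hcoe]
  have htm : Measurable fun ω => (τ ω).untopD 0 := by
    refine measurable_to_countable' fun n => ?_
    have : (fun ω => (τ ω).untopD 0) ⁻¹' {n} =
        {ω | τ ω = n} ∪ ({ω | τ ω = ⊤} ∩ {_ω : Ω | n = 0}) := by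
      ext ω
      rcases eq_top_or_eq_natCast (τ ω) with hω | ⟨k, hω⟩
      · simp [hω, eq_comm]
      · simp [hω, untopD_natCast]
    rw [this]
    exact (hτn' n).union (hτtop.inter (.const _))
  have hRm : Measurable R :=
    (measurable_from_prod_countable_left (f := fun q : (ℕ → ℝ) × ℕ => pathReward γ h y q.2 q.1)
      fun n => (measurable_pathReward hγm hhm n).comp (measurable_prodMk_left (x := y))).comp
      (hsm.prodMk htm)
  by_cases hneg : ∫⁻ ω, ENNReal.ofReal (-R ω) ∂P = ⊤
  · rw [expect_eq_bot]
    · exact bot_le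
    simpa only [← EReal.coe_neg, EReal.real_coe_toENNReal] using hneg
  have hpos : ∫⁻ ω, ENNReal.ofReal (R ω) ∂P ≠ ⊤ := by
    have hGm := measurable_supGain hγm hhm y
    have hGfin : ∀ᵐ ω ∂P, supGain γ h y (seq X ω) ≠ ⊤ :=
      ae_of_ae_map hsm.aemeasurable (M.ae_supGain_ne_top y)
    have hGi : Integrable (fun x => (supGain γ h y x).toReal) (P.map (seq X)) :=
      integrable_toReal_of_lintegral_ne_top hGm.aemeasurable (M.supGain_ne_top y)
    refine lintegral_ofReal_ne_top_of_le
      ((integrable_const (γ y)).add (hGi.comp_measurable hsm)) ?_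
    filter_upwards [hGfin] with ω hω
    have := pathReward_sub_le hω ((τ ω).untopD 0)
    simp only [Pi.add_apply, Function.comp_apply, hR]
    linarith
  have hRi := integrable_of_lintegral_parts_ne_top hRm.aestronglyMeasurable hpos hneg
  rw [expect_coe hRi, EReal.coe_le_coe_iff]
  exact M.integral_reward_le hX hindep hident hA hb ha hconc hwait hret y hτn hfin hRi

end Optimality

end RWStopping

/-! ### The main theorem -/

theorem mainTheorem3 {Ω : Type*} [MeasurableSpace Ω] (P : Measure Ω) [IsProbabilityMeasure P]
    (X : ℕ → Ω → ℝ) (hX : ∀ i, Measurable (X i))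
    (hindep : iIndepFun X P) (hident : ∀ i, IdentDistrib (X i) (X 0) P P)
    (hpos : 0 < P {ω | 0 < X 0 ω})
    (γ h : ℝ → ℝ) (hγ : Monotone γ) (hh : Monotone h) (hh0 : ∀ x, 0 ≤ h x)
    (hassum : RWStopping.StandingAssumption P X γ h)
    (hf : RWStopping.GainRateWellDefined P X γ h)
    (xbar : ℝ) (hxbar : IsGLB (RWStopping.noGainSet P X γ h) xbar)
    (hconc : ConcaveOn ℝ (Ici xbar) γ) :
    (RWStopping.gainRate P X γ h xbar ≤ 0 →
      ∀ y : ℝ, RWStopping.IsOptimal hX P γ h y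
        (hittingAfter (RWStopping.startedWalk X y) (Ici xbar) 0)) ∧
    (0 < RWStopping.gainRate P X γ h xbar →
      ∀ y : ℝ, RWStopping.IsOptimal hX P γ h y
        (hittingAfter (RWStopping.startedWalk X y) (Ioi xbar) 0)) := by
  have M := RWStopping.ladderModel hX hindep hident hpos hγ hh hh0 hassum hf
  have := Measure.isProbabilityMeasure_map (μ := P) (RWStopping.measurable_seq hX).aemeasurable
  have hmem := RWStopping.mem_noGainSet_iff hf
  have hrate : RWStopping.gainRate P X γ h xbar ≤ 0 ↔
      RWStopping.ladderReward P X γ h xbar ≤ γ xbar := by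
    rw [RWStopping.gainRate, (RWStopping.meanLadderTime_eq hX hf.meanLadderTime_lt_top).2.2,
      div_le_iff₀ M.integral_ladder_pos, zero_mul, sub_nonpos]
  simp only [RWStopping.ladderReward_eq hX M] at hmem hrate
  have hbelow : ∀ z < xbar, γ z ≤
      ∫ x, RWStopping.pathReward γ h z (RWStopping.ladder x) x ∂(P.map (RWStopping.seq X)) := by
    intro z hz
    by_contra! hcon
    exact absurd (hxbar.1 ((hmem z).2 hcon.le)) (not_le.2 hz)
  have habove : ∀ z, xbar < z →
      ∫ x, RWStopping.pathReward γ h z (RWStopping.ladder x) x ∂(P.map (RWStopping.seq X)) ≤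
        γ z := by
    intro z hz
    -- Some `v` in the no-gain set lies in `[xbar, z)`, and the ladder gain at `z` is no larger than
    -- at `v`.
    obtain ⟨v, hv, hxv, hvz⟩ := hxbar.exists_between hz
    have h1 := (hmem v).1 hv
    have h2 := M.ladder_gain_anti hconc hxv hvz.le
    linarith
  constructor
  · intro hrate0 y
    refine RWStopping.isOptimal_hittingAfter hX hindep hident M (isUpperSet_Ici xbar)
      Ioi_subset_Ici_self subset_rfl hconc (fun z hz => hbelow z (not_le.1 hz)) (fun z hz => ?_) y
    rcases (mem_Ici.1 hz).eq_or_lt with rfl | hlt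
    · exact hrate.1 hrate0
    · exact habove z hlt
  · intro hrate0 y
    refine RWStopping.isOptimal_hittingAfter hX hindep hident M (isUpperSet_Ioi xbar)
      subset_rfl Ioi_subset_Ici_self hconc (fun z hz => ?_) (fun z hz => habove z hz) y
    -- The boundary point now lies outside the stopping set, and waiting there is favourable because
    -- f is positive at it.
    rcases (not_lt.1 fun hlt => hz (mem_Ioi.2 hlt)).eq_or_lt with rfl | hlt
    · by_contra! hcon
      exact absurd (hrate.2 hcon.le) (not_le.2 hrate0)
    · exact hbelow z hlt
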